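/- All spaces are Tychonoff and all maps are continuous. **Definitions.** A map $f\colon A\to B$ is *skeletal* (resp. *semi-open*) if $\operatorname{Int}\overline{f(U)}\ne\varnothing$ (resp. $\operatorname{Int} f(U)\neq\varnothing$) for every non-empty open $U\subset A$. The *absolute* of a space $X$ is the extremally disconnected space $Z$ admitting a perfect irreducible map onto $X$ (a surjection is irreducible if no proper closed subset of its domain is mapped onto the whole codomain); two spaces are *co-absolute* if they have a common absolute. The weight $w$ is taken to be infinite by convention, i.e. $w(T)=\max\{\aleph_0,\min\{|\mathcal B|:\mathcal B\text{ is a base of }T\}\}$. For maps $\phi,f$ with the same domain, $\phi\prec f$ means that $f=g\circ\phi$ for some continuous $g\colon \phi(X)\to f(X)$. A *multiplicative lattice* on $X$ is a family $\Psi$ of maps $\phi\colon X\to\phi(X)$ onto their images (maps differing by a homeomorphism of the images being identified) such that * for every map $f\colon X\to f(X)$ there is $\phi\in\Psi$ with $\phi\prec f$ and $w(\phi(X))\le w(f(X))$; * the diagonal product $\triangle_{\alpha\in A}\phi_\alpha$ belongs to $\Psi$ for every family $\{\phi_\alpha:\alpha\in A\}\subset\Psi$. $X$ has a multiplicative lattice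 of open (semi-open) maps if there is such a $\Psi$ all of whose members are open (semi-open) as maps onto their images. $X$ is an *AE(0)-space* if for every space $Z$ with covering dimension $\dim Z\le 0$, every subspace $Z_0\subset Z$ and every map $f\colon Z_0\to X$ such that $g\circ f$ extends to a continuous real-valued function on $Z$ for each continuous $g\colon X\to\mathbb R$, the map $f$ extends to a map $Z\to X$. A space $X$ is *skeletally Dugundji* if there are an infinite cardinal $\tau$, identified with its initial ordinal, and an inverse system $S=\{X_\alpha,p^\beta_\alpha,\alpha<\beta<\tau\}$ with surjective skeletal bonding maps such that: (i) $X_0$ is a separable metrizable space and each $p^{\alpha+1}_\alpha$ has a metrizable kernel, i.e. there is a separable metrizable $M_\alpha$ and an embedding of $X_{\alpha+1}$ in $X_\alpha\times M_\alpha$ under which $p^{\alpha+1}_\alpha$ is the restriction of the projection onto $X_\alpha$; (ii) for each limit ordinal $\gamma<\tau$ the canonical map embeds $X_\gamma$ as a dense subset of $\varprojlim\{X_\alpha,p^\beta_\alpha,\alpha<\beta<\gamma\}$; (iii) $X$ is embedded in $\varprojlim S$ so that $p_\alpha(X)=X_\alpha$ for each $\alpha$, where $p_\alpha$ is the limit projection;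 (iv) for every bounded continuous $f\colon\varprojlim S\to\mathbb R$ there are $\alpha<\tau$ and a continuous $g\colon X_\alpha\to\mathbb R$ with $f=g\circ p_\alpha$. **Corollary.** Every space $Y$ co-absolute with a space possessing a multiplicative lattice of open maps is skeletally Dugundji. In particular, if $Y$ is co-absolute with an AE(0)-space, then $Y$ has a multiplicative lattice of semi-open maps and $Y$ is skeletally Dugundji. -/

import Mathlib

open Set Topology TopologicalSpace
open scoped BoundedContinuousFunction Cardinal

universe u

namespace SkelDug

/-! ### Classes of maps -/

/-- `f` is skeletal: `Int (Cl (f U)) ≠ ∅` for every non-empty open `U`. -/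
def IsSkeletal {A B : Type*} [TopologicalSpace A] [TopologicalSpace B] (f : A → B) : Prop :=
  ∀ U : Set A, IsOpen U → U.Nonempty → (interior (closure (f '' U))).Nonempty

/-- `f` is semi-open: `Int (f U) ≠ ∅` for every non-empty open `U`. -/
def IsSemiOpen {A B : Type*} [TopologicalSpace A] [TopologicalSpace B] (f : A → B) : Prop :=
  ∀ U : Set A, IsOpen U → U.Nonempty → (interior (f '' U)).Nonempty

/-- `f` is irreducible: it is onto, and no proper closed subset is mapped onto the codomain. -/
def IsIrreducibleMap {A B : Type*} [TopologicalSpace A] (f : A → B) : Prop :=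
  Function.Surjective f ∧ ∀ F : Set A, IsClosed F → f '' F = univ → F = univ

/-! ### Absolutes -/

/-- `θ : Z → X` exhibits `Z` as the absolute of `X`: `Z` is an extremally disconnected Tychonoff
space and `θ` is a perfect irreducible map onto `X`.  (Between Hausdorff spaces `IsProperMap` means
continuous, closed, with compact fibres, that is, perfect.) -/
def IsAbsolute {Z X : Type*} [TopologicalSpace Z] [TopologicalSpace X] (θ : Z → X) : Prop :=
  T35Space Z ∧ ExtremallyDisconnected Z ∧ IsProperMap θ ∧ IsIrreducibleMap θ

/-- `X` and `Y` are co-absolute: they have a common absolute. -/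
def CoAbsolute (X Y : Type u) [TopologicalSpace X] [TopologicalSpace Y] : Prop :=
  ∃ (Z : Type u) (_ : TopologicalSpace Z) (θX : Z → X) (θY : Z → Y),
    IsAbsolute θX ∧ IsAbsolute θY

/-! ### Multiplicative lattices -/

/-- The weight of a space.  As is customary for topological cardinal functions it is infinite by
convention, so that weight `ℵ₀` means second countable. -/
noncomputable def weight (X : Type u) [TopologicalSpace X] : Cardinal.{u} :=
  max ℵ₀ (sInf {κ | ∃ B : Set (Set X), IsTopologicalBasis B ∧ #B = κ})

/-- A map with domain `X`, regarded as a continuous map `φ : X → φ(X)` onto its (Tychonoff)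
image. -/
structure MapOnto (X : Type u) [TopologicalSpace X] where
  image : Type u
  [top : TopologicalSpace image]
  [tych : T35Space image]
  toFun : X → image
  cont : Continuous toFun
  surj : Function.Surjective toFun

attribute [instance] MapOnto.top MapOnto.tych

variable {X : Type u} [TopologicalSpace X]

/-- `φ ≺ f`: there is a continuous `g : φ(X) → f(X)` with `f = g ∘ φ`. -/
def MapOnto.Precedes (φ f : MapOnto X) : Prop :=
  ∃ g : φ.image → f.image, Continuous g ∧ ∀ x, f.toFun x = g (φ.toFun x)

/-- Two maps with domain `X` are identified if they differ by a homeomorphism of their images. -/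
def MapOnto.Same (φ ψ : MapOnto X) : Prop :=
  ∃ h : φ.image ≃ₜ ψ.image, ∀ x, h (φ.toFun x) = ψ.toFun x

/-- The diagonal product `x ↦ (φ a x)ₐ`, as a map onto its image in the product of the images. -/
def MapOnto.diagonal {A : Type u} (φ : A → MapOnto X) : MapOnto X where
  image := range (fun (x : X) (a : A) => (φ a).toFun x)
  toFun := rangeFactorization (fun (x : X) (a : A) => (φ a).toFun x)
  cont := (continuous_pi fun a => (φ a).cont).subtype_mk _
  surj := rangeFactorization_surjective

/-- `Ψ` is a multiplicative lattice on `X`: every map `f` on `X` is preceded by some `φ ∈ Ψ` with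
`w(φ(X)) ≤ w(f(X))`, and `Ψ` contains (up to a homeomorphism of images) the diagonal product of
every subfamily. -/
def IsMultiplicativeLattice (Ψ : Set (MapOnto X)) : Prop :=
  (∀ f : MapOnto X, ∃ φ ∈ Ψ, φ.Precedes f ∧ weight φ.image ≤ weight f.image) ∧
  (∀ (A : Type u) (φ : A → MapOnto X), (∀ a, φ a ∈ Ψ) →
    ∃ ψ ∈ Ψ, ψ.Same (MapOnto.diagonal φ))

variable (X) in
/-- `X` has a multiplicative lattice of open maps. -/
def HasLatticeOfOpenMaps : Prop :=
  ∃ Ψ : Set (MapOnto X), IsMultiplicativeLattice Ψ ∧ ∀ φ ∈ Ψ, IsOpenMap φ.toFun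

variable (X) in
/-- `X` has a multiplicative lattice of semi-open maps. -/
def HasLatticeOfSemiOpenMaps : Prop :=
  ∃ Ψ : Set (MapOnto X), IsMultiplicativeLattice Ψ ∧ ∀ φ ∈ Ψ, IsSemiOpen φ.toFun

/-! ### AE(0)-spaces -/

/-- Functionally open (cozero) sets. -/
def IsFunctionallyOpen {Z : Type*} [TopologicalSpace Z] (U : Set Z) : Prop :=
  ∃ g : C(Z, ℝ), U = {z | g z ≠ 0}

/-- `dim Z ≤ 0`, for the covering dimension of Tychonoff spaces: every finite functionally open
cover can be shrunk to a disjoint clopen cover. -/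
def DimLEZero (Z : Type*) [TopologicalSpace Z] : Prop :=
  ∀ (n : ℕ) (U : Fin n → Set Z), (∀ i, IsFunctionallyOpen (U i)) → ⋃ i, U i = univ →
    ∃ V : Fin n → Set Z, (∀ i, IsClopen (V i)) ∧ (∀ i, V i ⊆ U i) ∧
      Pairwise (Function.onFun Disjoint V) ∧ ⋃ i, V i = univ

/-- `X` is an AE(0)-space in Chigogidze's sense: whenever `Z` is a Tychonoff space with
`dim Z ≤ 0`, `Z₀ ⊆ Z`, and `f : Z₀ → X` is a map such that `g ∘ f` extends to a continuous function
on `Z` for every `g ∈ C(X)`, the map `f` itself extends to a continuous map `Z → X`. -/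
def IsAEZero (X : Type u) [TopologicalSpace X] : Prop :=
  ∀ (Z : Type u) [TopologicalSpace Z] [T35Space Z], DimLEZero Z →
    ∀ (Z₀ : Set Z) (f : C(Z₀, X)),
      (∀ g : C(X, ℝ), ∃ G : C(Z, ℝ), ∀ z : Z₀, G z = g (f z)) →
      ∃ F : C(Z, X), ∀ z : Z₀, F z = f z

/-! ### Inverse systems and skeletally Dugundji spaces -/

/-- Inverse systems of Tychonoff spaces and continuous maps; `bond h : X_β → X_α` for `h : α ≤ β`
is the bonding map `p^β_α`. -/
structure InvSystem (I : Type u) [Preorder I] where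
  space : I → Type u
  [top : ∀ α, TopologicalSpace (space α)]
  [tych : ∀ α, T35Space (space α)]
  bond : ∀ {α β : I}, α ≤ β → space β → space α
  cont : ∀ {α β : I} (h : α ≤ β), Continuous (bond h)
  bond_self : ∀ (α : I) (x : space α), bond (le_refl α) x = x
  bond_bond : ∀ {α β γ : I} (h₁ : α ≤ β) (h₂ : β ≤ γ) (x : space γ),
    bond h₁ (bond h₂ x) = bond (h₁.trans h₂) x

attribute [instance] InvSystem.top InvSystem.tych

variable {I : Type u} [Preorder I]

/-- The inverse limit, as a subspace of the product. -/
def InvSystem.Limit (S : InvSystem I) : Type u :=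
  {x : ∀ α, S.space α // ∀ ⦃α β : I⦄ (h : α ≤ β), S.bond h (x β) = x α}

instance (S : InvSystem I) : TopologicalSpace S.Limit :=
  inferInstanceAs (TopologicalSpace (Subtype _))

/-- The limit projection `p_α`. -/
def InvSystem.proj (S : InvSystem I) (α : I) (x : S.Limit) : S.space α := x.1 α

/-- The restriction of the system to the indices `α < γ`. -/
def InvSystem.below (S : InvSystem I) (γ : I) : InvSystem (Iio γ) where
  space α := S.space α
  bond h := S.bond h
  cont h := S.cont h
  bond_self α x := S.bond_self α x
  bond_bond h₁ h₂ x := S.bond_bond h₁ h₂ x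

/-- The canonical map `x ↦ (p^γ_α x)_{α < γ}` of `X_γ` into the limit of the system below `γ`. -/
def InvSystem.toLimitBelow (S : InvSystem I) (γ : I) (x : S.space γ) : (S.below γ).Limit :=
  ⟨fun α => S.bond (le_of_lt α.2) x, fun _ β h => S.bond_bond h (le_of_lt β.2) x⟩

/-- `p : E → B` has a metrizable kernel: for some separable metrizable `M`, the space `E` embeds in
`B × M` so that `p` becomes the restriction of the projection `B × M → B`. -/
def HasMetrizableKernel {E B : Type u} [TopologicalSpace E] [TopologicalSpace B] (p : E → B) :
    Prop :=
  ∃ (M : Type u) (_ : TopologicalSpace M), MetrizableSpace M ∧ SeparableSpace M ∧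
    ∃ e : E → B × M, IsEmbedding e ∧ ∀ x, (e x).1 = p x

/-- `X` is skeletally Dugundji.  The infinite cardinal `τ` is identified with its initial ordinal,
and the index set of the inverse system is the set of ordinals below it. -/
def SkeletallyDugundji (X : Type u) [TopologicalSpace X] : Prop :=
  ∃ (τ : Cardinal.{u}) (S : InvSystem τ.ord.ToType), ℵ₀ ≤ τ ∧
    -- the bonding maps are surjective and skeletal
    (∀ α β (h : α < β), Function.Surjective (S.bond h.le) ∧ IsSkeletal (S.bond h.le)) ∧
    -- `X_0` is a separable metric space
    (∀ α, IsMin α → MetrizableSpace (S.space α) ∧ SeparableSpace (S.space α)) ∧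
    -- the maps `p^{α+1}_α` have metrizable kernels
    (∀ α β (h : α ⋖ β), HasMetrizableKernel (S.bond h.le)) ∧
    -- for limit `γ`, the space `X_γ` is a dense subspace of the limit of the system below `γ`
    (∀ γ, Order.IsSuccLimit γ → IsEmbedding (S.toLimitBelow γ) ∧ DenseRange (S.toLimitBelow γ)) ∧
    -- `X` is embedded in the limit in such a way that `p_α(X) = X_α`
    (∃ e : X → S.Limit, IsEmbedding e ∧ ∀ α, S.proj α '' range e = univ) ∧
    -- the system is factorizing
    (∀ f : S.Limit →ᵇ ℝ, ∃ (α : τ.ord.ToType) (g : C(S.space α, ℝ)),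
      ∀ x, f x = g (S.proj α x))

end SkelDug

/-!
A continuous map on a Tychonoff space is handled through the set `H` of real functions that factor
through it: up to a homeomorphism of images it is the evaluation map `X → ℝ^H`, determined by the
topology `functionTopology H` on `X`.  A multiplicative lattice becomes a family of sets of
functions that is cofinal among the countable sets and closed under unions (`IsSetLattice`), and
such a family contains arbitrarily large countable sets closed under any given finitary operation
with countable values (`IsSetLattice.exists_closed`).

Let `θX : Z → X` and `θY : Z → Y` exhibit `Z` as a common absolute, and let `𝒢` be a lattice on `X`
with open evaluation maps.  Then `X`, hence `Z` and `Y`, satisfy the countable chain condition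
(`countableChainCondition_of_lattice`).  Therefore each open set determined by one function on `Y`
agrees, up to closures in `Z`, with an open set determined by countably many functions on `X`, and
conversely (`exists_countable_captures`).  The sets `H` of functions on `Y` having a partner `K ∈ 𝒢`
such that both are closed under this exchange form a lattice on `Y`; since `Z` is extremally
disconnected, `H` and `K` determine the same open sets up to closures in `Z`.  Openness of the
evaluation map of `K` and compactness of the fibres of `θX` then force the evaluation map of `H` to
be semi-open (`semiOpenEval_of_captures`): the set of values of `evalMap H ∘ θY` on the fibre of
`θX` over `x` depends only on `evalMap K x`.

A lattice of semi-open evaluation maps on `Y` is a multiplicative lattice of semi-open maps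
(`hasLatticeOfSemiOpenMaps_of_lattice`), and adding the functions on `Y` one at a time along a
well-order gives the inverse system required of a skeletally Dugundji space
(`skeletallyDugundji_of_lattice`).

For an AE(0)-space the lattice on `X` comes from an extension `F` of a partial map defined on a
power of a zero-dimensional separable metrizable space that is mapped onto `ℝ` by an open map
(`IsAEZero.exists_open_lattice`).  That powers of such spaces are zero-dimensional, and that the
lattice is cofinal, both follow from the fact that continuous real functions on them depend on
countably many coordinates (`exists_countable_dependsOn`).  The open map is the addition of two
irrational numbers.
-/

namespace SkelDug

/-! ### Closing off countable sets -/

/-- A family of subsets of `α` that is cofinal among the countable sets and closed under unions.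
For `α = C(X, ℝ)` this is what remains of a multiplicative lattice on `X` when a map is replaced by
the set of those real functions that factor through it. -/
structure IsSetLattice {α : Type*} (𝒢 : Set (Set α)) : Prop where
  cofinal : ∀ H : Set α, H.Countable → ∃ H' ∈ 𝒢, H'.Countable ∧ H ⊆ H'
  sUnion_mem : ∀ 𝒜 ⊆ 𝒢, ⋃₀ 𝒜 ∈ 𝒢

/-- Countable sets can be enlarged to countable members of `𝒢` that are closed under a prescribed
operation `N` with finitely many arguments and countable values. -/
theorem IsSetLattice.exists_closed {α : Type*} {𝒢 : Set (Set α)} (h𝒢 : IsSetLattice 𝒢)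
    (N : Finset α → Set α) (hN : ∀ F, (N F).Countable) {H : Set α} (hH : H.Countable) :
    ∃ H' ∈ 𝒢, H'.Countable ∧ H ⊆ H' ∧ ∀ F : Finset α, ↑F ⊆ H' → N F ⊆ H' := by
  choose G hG hGc hGs using h𝒢.cofinal
  have hcl : ∀ S : Set α, S.Countable → (S ∪ ⋃ F ∈ {F : Finset α | ↑F ⊆ S}, N F).Countable := by
    intro S hS
    refine hS.union (Countable.biUnion ?_ fun F _ => hN F)
    have hc : {F : Finset α | ↑F ⊆ S} ⊆ (fun F : Finset α => (F : Set α)) ⁻¹'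
        {T | T.Finite ∧ T ⊆ S} := fun F hF => ⟨F.finite_toSet, hF⟩
    exact ((countable_ofPred_finite_subset hS).preimage Finset.coe_injective).mono hc
  let S : ℕ → {S : Set α // S.Countable} := fun n => Nat.rec ⟨G H hH, hGc H hH⟩
    (fun _ S => ⟨G _ (hcl S.1 S.2), hGc _ _⟩) n
  have hS : ∀ n, (S n).1 ∈ 𝒢 := by
    rintro (_ | n)
    · exact hG _ _
    · exact hG _ _
  have hstep : ∀ n, (S n).1 ∪ ⋃ F ∈ {F : Finset α | ↑F ⊆ (S n).1}, N F ⊆ (S (n + 1)).1 :=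
    fun n => hGs _ (hcl (S n).1 (S n).2)
  have hmono : Monotone fun n => (S n).1 :=
    monotone_nat_of_le_succ fun n => subset_union_left.trans (hstep n)
  refine ⟨⋃₀ range fun n => (S n).1, h𝒢.sUnion_mem _ ?_, ?_, ?_, ?_⟩
  · rintro _ ⟨n, rfl⟩
    exact hS n
  · rw [sUnion_range]
    exact countable_iUnion fun n => (S n).2
  · rw [sUnion_range]
    exact (hGs H hH).trans (subset_iUnion (fun n => (S n).1) 0)
  · intro F hF
    rw [sUnion_range] at hF ⊢
    obtain ⟨n, hn⟩ := hmono.directed_le.exists_mem_subset_of_finset_subset_biUnion hF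
    have : N F ⊆ (S (n + 1)).1 :=
      (subset_biUnion_of_mem (u := fun F => N F)
        (show F ∈ {F : Finset α | ↑F ⊆ (S n).1} from hn)).trans
        (subset_union_right.trans (hstep n))
    exact this.trans (subset_iUnion (fun n => (S n).1) (n + 1))

theorem isSetLattice_univ {α : Type*} : IsSetLattice (univ : Set (Set α)) :=
  ⟨fun H hH => ⟨H, mem_univ _, hH, Subset.rfl⟩, fun _ _ => mem_univ _⟩

/-! ### Topologies generated by continuous functions -/

section FunctionTopology

variable {X : Type*} [TopologicalSpace X]

/-- The evaluation map `X → ℝ^H` of a set `H` of continuous functions. -/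
def evalMap (H : Set C(X, ℝ)) (x : X) (h : H) : ℝ := h.1 x

theorem continuous_evalMap (H : Set C(X, ℝ)) : Continuous (evalMap H) :=
  continuous_pi fun h => h.1.continuous

/-- The coarsest topology on `X` for which all functions in `H` are continuous.  It need not be
`T₀`, and its Kolmogorov quotient is the image of the evaluation map. -/
abbrev functionTopology (H : Set C(X, ℝ)) : TopologicalSpace X :=
  induced (evalMap H) inferInstance

theorem functionTopology_eq_iInf (H : Set C(X, ℝ)) :
    functionTopology H = ⨅ h ∈ H, induced (h : X → ℝ) inferInstance := by
  rw [functionTopology, Pi.topologicalSpace, induced_iInf, iInf_subtype']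
  simp only [induced_compose]
  rfl

theorem le_functionTopology (H : Set C(X, ℝ)) : ‹TopologicalSpace X› ≤ functionTopology H :=
  continuous_iff_le_induced.1 (continuous_evalMap H)

theorem functionTopology_anti {H K : Set C(X, ℝ)} (h : H ⊆ K) :
    functionTopology K ≤ functionTopology H := by
  simp only [functionTopology_eq_iInf]
  exact biInf_mono h

theorem functionTopology_le_induced {H : Set C(X, ℝ)} {g : C(X, ℝ)} (hg : g ∈ H) :
    functionTopology H ≤ induced (g : X → ℝ) inferInstance := by
  rw [functionTopology_eq_iInf]
  exact iInf₂_le g hg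

theorem functionTopology_sUnion (𝒜 : Set (Set C(X, ℝ))) :
    functionTopology (⋃₀ 𝒜) = ⨅ H ∈ 𝒜, functionTopology H := by
  simp only [functionTopology_eq_iInf]
  refine le_antisymm (le_iInf₂ fun H hH => biInf_mono (subset_sUnion_of_mem hH)) ?_
  refine le_iInf₂ fun g hg => ?_
  obtain ⟨H, hH, hgH⟩ := hg
  exact (iInf₂_le H hH).trans (iInf₂_le g hgH)

theorem isOpen_functionTopology_iff {H : Set C(X, ℝ)} {V : Set X} :
    IsOpen[functionTopology H] V ↔ ∃ W : Set (H → ℝ), IsOpen W ∧ evalMap H ⁻¹' W = V :=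
  isOpen_induced_iff

theorem mem_of_isOpen_functionTopology {H : Set C(X, ℝ)} {V : Set X}
    (hV : IsOpen[functionTopology H] V) {x y : X} (hxy : ∀ h ∈ H, h x = h y) (hx : x ∈ V) :
    y ∈ V := by
  obtain ⟨W, -, rfl⟩ := isOpen_functionTopology_iff.1 hV
  have : evalMap H x = evalMap H y := funext fun h => hxy h.1 h.2
  simpa [← this] using hx

theorem isOpen_functionTopology_ne_zero {H : Set C(X, ℝ)} {g : C(X, ℝ)} (hg : g ∈ H) :
    IsOpen[functionTopology H] {x | g x ≠ 0} :=
  functionTopology_le_induced hg _ (isOpen_induced isOpen_ne)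

theorem exists_finset_isOpen_functionTopology {H : Set C(X, ℝ)} {V : Set X}
    (hV : IsOpen[functionTopology H] V) {x : X} (hx : x ∈ V) :
    ∃ F : Finset C(X, ℝ), ↑F ⊆ H ∧
      ∃ O : Set X, IsOpen[functionTopology (F : Set C(X, ℝ))] O ∧ x ∈ O ∧ O ⊆ V := by
  classical
  obtain ⟨W, hW, rfl⟩ := isOpen_functionTopology_iff.1 hV
  obtain ⟨I, u, hu, hs⟩ := isOpen_pi_iff.1 hW _ hx
  refine ⟨I.image Subtype.val, by simp, ⋂ h ∈ I, h.1 ⁻¹' (u h), ?_, ?_, ?_⟩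
  · refine @isOpen_biInter_finset _ _ (_) _ _ fun h hh => ?_
    refine functionTopology_le_induced (g := h.1) ?_ _ (isOpen_induced (hu h hh).1)
    simpa using hh
  · simp only [mem_iInter, mem_preimage]
    exact fun h hh => (hu h hh).2
  · intro y hy
    simp only [mem_iInter, mem_preimage] at hy
    exact hs fun h hh => hy h hh

theorem secondCountableTopology_functionTopology {H : Set C(X, ℝ)} (hH : H.Countable) :
    @SecondCountableTopology X (functionTopology H) := by
  have := hH.to_subtype
  exact secondCountableTopology_induced _ _ _

/-- The saturation of `U` with respect to the equivalence relation of having the same values under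
all functions in `H`, that is, the preimage of the image of `U` under the evaluation map. -/
def saturation (H : Set C(X, ℝ)) (U : Set X) : Set X :=
  {x | ∃ y ∈ U, ∀ h ∈ H, h x = h y}

theorem subset_saturation (H : Set C(X, ℝ)) (U : Set X) : U ⊆ saturation H U :=
  fun x hx => ⟨x, hx, fun _ _ => rfl⟩

/-- The evaluation map of `H` is open as a map onto its image. -/
def OpenEval (H : Set C(X, ℝ)) : Prop :=
  ∀ U : Set X, IsOpen U → IsOpen[functionTopology H] (saturation H U)

/-- The evaluation map of `H` is semi-open as a map onto its image. -/
def SemiOpenEval (H : Set C(X, ℝ)) : Prop :=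
  ∀ U : Set X, IsOpen U → U.Nonempty →
    ∃ V : Set X, IsOpen[functionTopology H] V ∧ V.Nonempty ∧ V ⊆ saturation H U

theorem exists_cozero_subset [CompletelyRegularSpace X] {U : Set X} (hU : IsOpen U) {x : X}
    (hx : x ∈ U) : ∃ g : C(X, ℝ), g x ≠ 0 ∧ {y | g y ≠ 0} ⊆ U := by
  obtain ⟨f, hf, hfx, hfU⟩ := CompletelyRegularSpace.completely_regular x Uᶜ hU.isClosed_compl
    (by simpa using hx)
  refine ⟨⟨fun y => 1 - (f y : ℝ), by fun_prop⟩, by simp [hfx], fun y hy => ?_⟩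
  by_contra hyU
  exact hy (by simp [hfU hyU])

end FunctionTopology

/-! ### The countable chain condition -/

/-- Every family of pairwise disjoint non-empty open sets is countable. -/
def CountableChainCondition (X : Type*) [TopologicalSpace X] : Prop :=
  ∀ 𝒰 : Set (Set X), (∀ U ∈ 𝒰, IsOpen U ∧ U.Nonempty) → 𝒰.PairwiseDisjoint id → 𝒰.Countable

theorem CountableChainCondition.exists_cozero_dense {X : Type*} [TopologicalSpace X]
    [CompletelyRegularSpace X] (hX : CountableChainCondition X) {V : Set X} (hV : IsOpen V) :
    ∃ K : Set C(X, ℝ), K.Countable ∧ (⋃ k ∈ K, {x | k x ≠ 0}) ⊆ V ∧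
      V ⊆ closure (⋃ k ∈ K, {x | k x ≠ 0}) := by
  let 𝒞 : Set (Set (Set X)) := {𝒰 | (∀ U ∈ 𝒰, U.Nonempty ∧ U ⊆ V ∧
    ∃ g : C(X, ℝ), {x | g x ≠ 0} = U) ∧ 𝒰.PairwiseDisjoint id}
  obtain ⟨𝒰, h𝒰⟩ := zorn_subset 𝒞 (by
    intro c hc hchain
    refine ⟨⋃₀ c, ⟨?_, ?_⟩, fun s hs => subset_sUnion_of_mem hs⟩
    · rintro U ⟨𝒰, h𝒰, hU⟩
      exact (hc h𝒰).1 U hU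
    · exact (pairwiseDisjoint_sUnion hchain.directedOn).2 fun 𝒰 h𝒰 => (hc h𝒰).2)
  have hopen : ∀ U ∈ 𝒰, IsOpen U ∧ U.Nonempty := by
    intro U hU
    obtain ⟨hne, -, g, rfl⟩ := h𝒰.prop.1 U hU
    exact ⟨isOpen_ne_fun g.continuous continuous_const, hne⟩
  have hcount := hX 𝒰 hopen h𝒰.prop.2
  choose! g hg using fun U hU => (h𝒰.prop.1 U hU).2.2
  have hunion : (⋃ k ∈ g '' 𝒰, {x | k x ≠ 0}) = ⋃₀ 𝒰 := by
    rw [biUnion_image, sUnion_eq_biUnion]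
    exact iUnion₂_congr hg
  refine ⟨g '' 𝒰, hcount.image g, ?_, ?_⟩
  · rw [hunion]
    exact sUnion_subset fun U hU => (h𝒰.prop.1 U hU).2.1
  · rw [hunion]
    intro x hx
    by_contra hxc
    obtain ⟨k, hkx, hk⟩ := exists_cozero_subset (hV.sdiff isClosed_closure)
      (show x ∈ V \ closure (⋃₀ 𝒰) from ⟨hx, hxc⟩)
    -- the cozero set of `k` could be added to the maximal family
    have hdisj : ∀ U ∈ 𝒰, Disjoint {x | k x ≠ 0} U := fun U hU =>
      disjoint_left.2 fun y hy hyU => (hk hy).2 (subset_closure ⟨U, hU, hyU⟩)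
    have hmem : insert {x | k x ≠ 0} 𝒰 ∈ 𝒞 := by
      refine ⟨?_, ?_⟩
      · rintro U (rfl | hU)
        · exact ⟨⟨x, hkx⟩, hk.trans sdiff_subset, k, rfl⟩
        · exact h𝒰.prop.1 U hU
      · exact h𝒰.prop.2.insert fun U hU _ => hdisj U hU
    have hin : {x | k x ≠ 0} ∈ 𝒰 := h𝒰.le_of_ge hmem (subset_insert _ _) (mem_insert _ _)
    exact (hk hkx).2 (subset_closure ⟨_, hin, hkx⟩)

/-- If the evaluation maps of a lattice of sets of functions are open, the space satisfies the
countable chain condition: a countable `H` in the lattice, suitably closed off, contains,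
for each member of a disjoint family, a non-zero function vanishing outside it. -/
theorem countableChainCondition_of_lattice {X : Type*} [TopologicalSpace X]
    [CompletelyRegularSpace X] {𝒢 : Set (Set C(X, ℝ))} (h𝒢 : IsSetLattice 𝒢)
    (hopen : ∀ H ∈ 𝒢, OpenEval H) : CountableChainCondition X := by
  classical
  intro 𝒰 h𝒰 hdisj
  have hg : ∀ U ∈ 𝒰, ∃ g : C(X, ℝ), (∃ x, g x ≠ 0) ∧ {y | g y ≠ 0} ⊆ U := by
    intro U hU
    obtain ⟨x, hx⟩ := (h𝒰 U hU).2
    obtain ⟨g, hgx, hg⟩ := exists_cozero_subset (h𝒰 U hU).1 hx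
    exact ⟨g, ⟨x, hgx⟩, hg⟩
  choose! g hgne hgU using hg
  -- every set open for `F` that meets one of the chosen cozero sets meets one whose function is in
  -- the countable set `N F`; a set `H` closed under `N` contains the functions of all of them
  have hN : ∀ F : Finset C(X, ℝ), ∃ N : Set C(X, ℝ), N.Countable ∧
      ∀ O : Set X, IsOpen[functionTopology (F : Set C(X, ℝ))] O → ∀ x ∈ O,
        (∃ U ∈ 𝒰, g U x ≠ 0) → ∃ U ∈ 𝒰, g U ∈ N ∧ ∃ y ∈ O, g U y ≠ 0 := by
    intro F
    have := secondCountableTopology_functionTopology F.countable_toSet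
    let t := functionTopology (F : Set C(X, ℝ))
    have hch : ∀ b : Set X, ∃ U, (∃ U ∈ 𝒰, ∃ y ∈ b, g U y ≠ 0) → U ∈ 𝒰 ∧ ∃ y ∈ b, g U y ≠ 0 := by
      intro b
      by_cases h : ∃ U ∈ 𝒰, ∃ y ∈ b, g U y ≠ 0
      · obtain ⟨U, hU⟩ := h
        exact ⟨U, fun _ => hU⟩
      · exact ⟨∅, fun h' => absurd h' h⟩
    choose U hU using hch
    refine ⟨(fun b => g (U b)) '' (@countableBasis X t this),
      (@countable_countableBasis X t this).image _, ?_⟩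
    rintro O hO x hx ⟨W, hW, hWx⟩
    obtain ⟨b, hb, hxb, hbO⟩ :=
      (@isBasis_countableBasis X t this).exists_subset_of_mem_open hx hO
    obtain ⟨hUb, y, hyb, hy⟩ := hU b ⟨W, hW, x, hxb, hWx⟩
    exact ⟨U b, hUb, ⟨b, hb, rfl⟩, y, hbO hyb, hy⟩
  choose N hNc hN using hN
  obtain ⟨H, hH, hHc, -, hHN⟩ := h𝒢.exists_closed N hNc countable_empty
  have hsub : ∀ B ∈ 𝒰, g B ∈ H := by
    intro B hB
    obtain ⟨x, hx⟩ := hgne B hB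
    have hop := hopen H hH {y | g B y ≠ 0} (isOpen_ne_fun (g B).continuous continuous_const)
    obtain ⟨F, hF, O, hO, hxO, hOs⟩ :=
      exists_finset_isOpen_functionTopology hop (subset_saturation _ _ hx)
    obtain ⟨U, hU, hUN, y, hyO, hy⟩ := hN F O hO x hxO ⟨B, hB, hx⟩
    have hUH : g U ∈ H := hHN F hF hUN
    obtain ⟨y', hy'B, hyy'⟩ := hOs hyO
    rw [hyy' _ hUH] at hy
    have : U = B := by
      by_contra hne
      exact disjoint_left.1 (hdisj hU hB hne) (hgU U hU hy) (hgU B hB hy'B)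
    exact this ▸ hUH
  refine MapsTo.countable_of_injOn hsub (fun U hU U' hU' h => ?_) hHc
  obtain ⟨x, hx⟩ := hgne U hU
  by_contra hne
  exact disjoint_left.1 (hdisj hU hU' hne) (hgU U hU hx) (hgU U' hU' (by simpa [← h] using hx))

/-! ### Closed irreducible maps -/

section Irreducible

variable {Z X : Type*}

theorem preimage_kernImage_subset (θ : Z → X) (A : Set Z) : θ ⁻¹' kernImage θ A ⊆ A :=
  fun _ hz => hz rfl

variable [TopologicalSpace Z] {θ : Z → X}

theorem IsIrreducibleMap.kernImage_nonempty (hirr : IsIrreducibleMap θ) {A : Set Z}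
    (hA : IsOpen A) (hne : A.Nonempty) : (kernImage θ A).Nonempty := by
  by_contra h
  rw [not_nonempty_iff_eq_empty, kernImage_eq_compl, compl_empty_iff] at h
  have := hirr.2 Aᶜ hA.isClosed_compl h
  exact hne.ne_empty (by simpa using this)

variable [TopologicalSpace X]

theorem IsIrreducibleMap.closure_preimage_eq (hirr : IsIrreducibleMap θ) (hcl : IsClosedMap θ)
    {A : Set Z} (hA : IsOpen A) {V : Set X} (hV : V ⊆ kernImage θ A)
    (hd : kernImage θ A ⊆ closure V) : closure (θ ⁻¹' V) = closure A := by
  refine (closure_mono ((preimage_mono hV).trans (preimage_kernImage_subset θ A))).antisymm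
    (closure_minimal (fun z hz => mem_closure_iff.2 fun B hB hzB => ?_) isClosed_closure)
  have hopen := isClosedMap_iff_kernImage.1 hcl (hA.inter hB)
  obtain ⟨x, hx⟩ := hirr.kernImage_nonempty (hA.inter hB) ⟨z, hz, hzB⟩
  obtain ⟨y, hy, hyV⟩ := mem_closure_iff.1 (hd (kernImage_mono inter_subset_left hx)) _ hopen hx
  obtain ⟨w, rfl⟩ := hirr.1 y
  exact ⟨w, (hy rfl).2, hyV⟩

/-- The countable chain condition is inherited by the domain of a closed irreducible map. -/
theorem CountableChainCondition.of_irreducible (hX : CountableChainCondition X)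
    (hcl : IsClosedMap θ) (hirr : IsIrreducibleMap θ) : CountableChainCondition Z := by
  intro 𝒰 h𝒰 hdisj
  have hdisj' : ∀ U ∈ 𝒰, ∀ U' ∈ 𝒰, (kernImage θ U ∩ kernImage θ U').Nonempty → U = U' := by
    rintro U hU U' hU' ⟨x, hx, hx'⟩
    obtain ⟨z, rfl⟩ := hirr.1 x
    by_contra hne
    exact disjoint_left.1 (hdisj hU hU' hne) (hx rfl) (hx' rfl)
  have hinj : InjOn (kernImage θ) 𝒰 := fun U hU U' hU' h => hdisj' U hU U' hU' (by
    rw [← h, inter_self]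
    exact hirr.kernImage_nonempty (h𝒰 U hU).1 (h𝒰 U hU).2)
  refine countable_of_injective_of_countable_image hinj (hX _ ?_ ?_)
  · rintro _ ⟨U, hU, rfl⟩
    exact ⟨isClosedMap_iff_kernImage.1 hcl (h𝒰 U hU).1,
      hirr.kernImage_nonempty (h𝒰 U hU).1 (h𝒰 U hU).2⟩
  · rintro _ ⟨U, hU, rfl⟩ _ ⟨U', hU', rfl⟩ hne
    refine disjoint_iff_inter_eq_empty.2 (not_nonempty_iff_eq_empty.1 fun h => hne ?_)
    rw [hdisj' U hU U' hU' h]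

theorem CountableChainCondition.image (hZ : CountableChainCondition Z) (hθ : Continuous θ)
    (hs : Function.Surjective θ) : CountableChainCondition X := by
  intro 𝒰 h𝒰 hdisj
  refine countable_of_injective_of_countable_image (f := preimage θ)
    hs.preimage_injective.injOn (hZ _ ?_ ?_)
  · rintro _ ⟨U, hU, rfl⟩
    exact ⟨(h𝒰 U hU).1.preimage hθ, (h𝒰 U hU).2.preimage hs⟩
  · rintro _ ⟨U, hU, rfl⟩ _ ⟨U', hU', rfl⟩ hne
    exact (hdisj hU hU' fun h => hne (by rw [h])).preimage θ

end Irreducible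

theorem exists_isOpen_subset_isClosed {X : Type*} [TopologicalSpace X] [RegularSpace X]
    {V : Set X} (hV : IsOpen V) {x : X} (hx : x ∈ V) :
    ∃ O C : Set X, IsOpen O ∧ x ∈ O ∧ O ⊆ C ∧ IsClosed C ∧ C ⊆ V := by
  obtain ⟨C, hCn, hCc, hCV⟩ := exists_mem_nhds_isClosed_subset (hV.mem_nhds hx)
  obtain ⟨O, hOC, hO, hxO⟩ := mem_nhds_iff.1 hCn
  exact ⟨O, C, hO, hxO, hOC, hCc, hCV⟩

/-! ### Comparing open sets of two irreducible images -/

section Captures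

variable {Z X Y : Type*} [TopologicalSpace Z]

/-- Up to closures in `Z`, the preimage of every `s`-open set of `Y` is the preimage of a `t`-open
set of `X`.  In terms of regular open algebras, the subalgebra determined by `s` is contained in
the one determined by `t`. -/
def Captures (θY : Z → Y) (θX : Z → X) (s : TopologicalSpace Y) (t : TopologicalSpace X) : Prop :=
  ∀ U, IsOpen[s] U → ∃ V, IsOpen[t] V ∧ closure (θY ⁻¹' U) = closure (θX ⁻¹' V)

variable {θY : Z → Y} {θX : Z → X}

theorem Captures.mono {s : TopologicalSpace Y} {t t' : TopologicalSpace X}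
    (h : Captures θY θX s t) (ht : t' ≤ t) : Captures θY θX s t' := fun U hU =>
  let ⟨V, hV, hUV⟩ := h U hU
  ⟨V, ht V hV, hUV⟩

theorem closure_inter_of_extremallyDisconnected [ExtremallyDisconnected Z] {A B : Set Z}
    (hA : IsOpen A) (hB : IsOpen B) : closure (A ∩ B) = closure A ∩ closure B := by
  refine (closure_inter_subset_inter_closure A B).antisymm fun z hz => ?_
  have h₁ : z ∈ closure (closure A ∩ B) :=
    (ExtremallyDisconnected.open_closure A hA).inter_closure hz
  refine closure_minimal ?_ isClosed_closure h₁
  rw [inter_comm, inter_comm A]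
  exact hB.inter_closure

/-- It suffices to capture the members of a subbase.  Extremal disconnectedness of `Z` is what
makes finite intersections harmless. -/
theorem captures_generateFrom [tX : TopologicalSpace X] [tY : TopologicalSpace Y]
    [ExtremallyDisconnected Z] (hθY : Continuous[_, tY] θY) (hθX : Continuous[_, tX] θX)
    {S : Set (Set Y)} (hS : ∀ U ∈ S, IsOpen[tY] U)
    {t : TopologicalSpace X} (ht : tX ≤ t)
    (h : ∀ U ∈ S, ∃ V, IsOpen[t] V ∧ closure (θY ⁻¹' U) = closure (θX ⁻¹' V)) :
    Captures θY θX (generateFrom S) t := by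
  have hXo : ∀ V, IsOpen[t] V → IsOpen (θX ⁻¹' V) := fun V hV =>
    (@continuous_def _ _ _ tX _).1 hθX V (ht V hV)
  have hle : tY ≤ generateFrom S := le_generateFrom hS
  intro U hU
  induction hU with
  | basic U hU => exact h U hU
  | univ => exact ⟨univ, @isOpen_univ _ t, rfl⟩
  | inter U U' hU hU' ih ih' =>
    obtain ⟨V, hV, e⟩ := ih
    obtain ⟨V', hV', e'⟩ := ih'
    refine ⟨V ∩ V', @IsOpen.inter _ t _ _ hV hV', ?_⟩
    rw [preimage_inter, preimage_inter,
      closure_inter_of_extremallyDisconnected ((hle U hU).preimage hθY) ((hle U' hU').preimage hθY),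
      closure_inter_of_extremallyDisconnected (hXo V hV) (hXo V' hV'),
      e, e']
  | sUnion 𝒰 h𝒰 ih =>
    choose! V hV e using ih
    refine ⟨⋃ U ∈ 𝒰, V U, @isOpen_biUnion _ _ t _ _ hV, ?_⟩
    rw [sUnion_eq_biUnion, preimage_iUnion₂, preimage_iUnion₂]
    refine (closure_minimal (iUnion₂_subset fun U hU => ?_) isClosed_closure).antisymm
      (closure_minimal (iUnion₂_subset fun U hU => ?_) isClosed_closure)
    · refine subset_closure.trans ((e U hU).trans_subset (closure_mono ?_))
      exact subset_biUnion_of_mem (u := fun U => θX ⁻¹' V U) hU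
    · refine subset_closure.trans ((e U hU).symm.trans_subset (closure_mono ?_))
      exact subset_biUnion_of_mem (u := fun U => θY ⁻¹' U) hU

variable [tX : TopologicalSpace X] [tY : TopologicalSpace Y]

/-- The open sets determined by one function on `Y` are captured by countably many functions
on `X`. -/
theorem exists_countable_captures [ExtremallyDisconnected Z] [CompletelyRegularSpace X]
    (hX : CountableChainCondition X) (hθY : Continuous θY) (hθX : Continuous θX)
    (hcl : IsClosedMap θX) (hirr : IsIrreducibleMap θX) (g : C(Y, ℝ)) :
    ∃ K : Set C(X, ℝ), K.Countable ∧
      Captures θY θX (induced (g : Y → ℝ) inferInstance) (functionTopology K) := by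
  have key : ∀ b : Set ℝ, ∃ K : Set C(X, ℝ), K.Countable ∧ (IsOpen b →
      ∃ V, IsOpen[functionTopology K] V ∧ closure (θY ⁻¹' (g ⁻¹' b)) = closure (θX ⁻¹' V)) := by
    intro b
    by_cases hb : IsOpen b
    · have hA : IsOpen (θY ⁻¹' (g ⁻¹' b)) := (hb.preimage g.continuous).preimage hθY
      obtain ⟨K, hKc, hK, hKd⟩ := hX.exists_cozero_dense (isClosedMap_iff_kernImage.1 hcl hA)
      refine ⟨K, hKc, fun _ => ⟨_, ?_, (hirr.closure_preimage_eq hcl hA hK hKd).symm⟩⟩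
      exact @isOpen_biUnion _ _ (functionTopology K) _ _ fun k hk =>
        isOpen_functionTopology_ne_zero hk
    · exact ⟨∅, countable_empty, fun h => absurd h hb⟩
  choose K hKc hK using key
  refine ⟨⋃ b ∈ countableBasis ℝ, K b, (countable_countableBasis ℝ).biUnion fun b _ => hKc b, ?_⟩
  have e : induced (g : Y → ℝ) inferInstance =
      generateFrom (preimage (g : Y → ℝ) '' countableBasis ℝ) :=
    (congrArg (induced (g : Y → ℝ)) (isBasis_countableBasis ℝ).eq_generateFrom).trans
      induced_generateFrom_eq
  rw [e]
  refine captures_generateFrom hθY hθX ?_ (le_functionTopology _) ?_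
  · rintro _ ⟨b, hb, rfl⟩
    exact (isOpen_of_mem_countableBasis hb).preimage g.continuous
  · rintro _ ⟨b, hb, rfl⟩
    obtain ⟨V, hV, hbV⟩ := hK b (isOpen_of_mem_countableBasis hb)
    exact ⟨V, functionTopology_anti (subset_biUnion_of_mem (u := K) hb) V hV, hbV⟩

theorem captures_functionTopology [ExtremallyDisconnected Z] (hθY : Continuous[_, tY] θY)
    (hθX : Continuous[_, tX] θX) {H : Set C(Y, ℝ)} {t : TopologicalSpace X} (ht : tX ≤ t)
    (h : ∀ g ∈ H, Captures θY θX (induced (g : Y → ℝ) inferInstance) t) :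
    Captures θY θX (functionTopology H) t := by
  rw [functionTopology_eq_iInf, iInf_subtype', ← generateFrom_iUnion_isOpen]
  refine @captures_generateFrom Z X Y _ θY θX tX tY _ hθY hθX _ ?_ t ht ?_
  · intro U hU
    obtain ⟨g, hg⟩ := mem_iUnion.1 hU
    exact continuous_iff_le_induced.1 g.1.continuous U hg
  · intro U hU
    obtain ⟨g, hg⟩ := mem_iUnion.1 hU
    exact h g.1 g.2 U hg

/-- If the functions in `H` on `Y` and the functions in `K` on `X` determine the same open sets up
to closures in `Z`, and the evaluation map of `K` is open, then the evaluation map of `H` is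
semi-open. -/
theorem semiOpenEval_of_captures (hθY : Continuous θY)
    (hsY : Function.Surjective θY)
    (hθX : IsProperMap θX) (hirr : IsIrreducibleMap θX) {H : Set C(Y, ℝ)} {K : Set C(X, ℝ)}
    (hK : OpenEval K) (hHK : Captures θY θX (functionTopology H) (functionTopology K))
    (hKH : Captures θX θY (functionTopology K) (functionTopology H)) : SemiOpenEval H := by
  -- the set of values of `evalMap H ∘ θY` on a fibre of `θX` depends only on `evalMap K`
  have fibre : ∀ x x' : X, (∀ k ∈ K, k x' = k x) → ∀ z, θX z = x' →
      ∃ w, θX w = x ∧ ∀ h ∈ H, h (θY z) = h (θY w) := by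
    intro x x' hxx' z hz
    by_contra! hno
    have hec : Continuous fun w => evalMap H (θY w) := (continuous_evalMap H).comp hθY
    have hcomp : IsCompact ((fun w => evalMap H (θY w)) '' (θX ⁻¹' {x})) :=
      (hθX.isCompact_preimage isCompact_singleton).image hec
    have hnot : evalMap H (θY z) ∉ (fun w => evalMap H (θY w)) '' (θX ⁻¹' {x}) := by
      rintro ⟨w, hw, hwz⟩
      obtain ⟨h, hh, hne⟩ := hno w hw
      exact hne (congrFun hwz ⟨h, hh⟩).symm
    obtain ⟨V₁, V₂, hV₁, hV₂, hz₁, hc₂, hd⟩ :=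
      SeparatedNhds.of_isCompact_isCompact isCompact_singleton hcomp
        (disjoint_singleton_left.2 hnot)
    obtain ⟨O, hO, hcl⟩ := hHK (evalMap H ⁻¹' V₁) (isOpen_induced hV₁)
    have hzE : z ∈ closure (θX ⁻¹' O) := by
      rw [← hcl]
      exact subset_closure (hz₁ rfl)
    have hx' : x' ∈ closure O := by
      rw [← hz]
      exact map_mem_closure hθX.continuous hzE fun w hw => hw
    have hx : x ∈ closure O := by
      refine mem_closure_iff.2 fun G hG hxG => ?_
      obtain ⟨v, hv, hvO⟩ := mem_closure_iff.1 hx' _ (le_functionTopology K _ (hK G hG))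
        ⟨x, hxG, hxx'⟩
      obtain ⟨v', hv'G, hvv'⟩ := hv
      exact ⟨v', hv'G, mem_of_isOpen_functionTopology hO hvv' hvO⟩
    have hsub : O ⊆ θX '' closure (θX ⁻¹' O) := by
      intro v hv
      obtain ⟨w, rfl⟩ := hirr.1 v
      exact ⟨w, subset_closure hv, rfl⟩
    obtain ⟨w, hw, hwx⟩ :=
      closure_minimal hsub (hθX.isClosedMap _ isClosed_closure) hx
    rw [← hcl] at hw
    obtain ⟨v, hv, hv₁⟩ := mem_closure_iff.1 hw _ (hV₂.preimage hec) (hc₂ ⟨w, hwx, rfl⟩)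
    exact disjoint_left.1 hd hv₁ hv
  intro U hU hne
  obtain ⟨x₁, hx₁⟩ := hirr.kernImage_nonempty (hU.preimage hθY) (hne.preimage hsY)
  have hU₁ : IsOpen (kernImage θX (θY ⁻¹' U)) :=
    isClosedMap_iff_kernImage.1 hθX.isClosedMap (hU.preimage hθY)
  have hsat := hK _ hU₁
  have hreg : @RegularSpace X (functionTopology K) := regularSpace_induced _
  obtain ⟨O, C, hO, hxO, hOC, hCc, hCs⟩ :=
    @exists_isOpen_subset_isClosed X (functionTopology K) hreg _ hsat _ (subset_saturation _ _ hx₁)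
  obtain ⟨W, hW, hcl⟩ := hKH O hO
  have hCX : IsClosed C := @IsClosed.mono _ _ _ _ hCc (le_functionTopology K)
  refine ⟨W, hW, ?_, ?_⟩
  · obtain ⟨z, rfl⟩ := hirr.1 x₁
    have : (closure (θY ⁻¹' W)).Nonempty := by
      rw [← hcl]
      exact ⟨z, subset_closure hxO⟩
    obtain ⟨w, hw⟩ := closure_nonempty_iff.1 this
    exact ⟨θY w, hw⟩
  · intro y hy
    obtain ⟨z, rfl⟩ := hsY y
    have hz : z ∈ closure (θX ⁻¹' O) := by
      rw [hcl]
      exact subset_closure hy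
    have hzC : θX z ∈ C := closure_minimal (preimage_mono hOC)
      (hCX.preimage hθX.continuous) hz
    obtain ⟨x, hx, hxz⟩ := hCs hzC
    obtain ⟨w, rfl, hw⟩ := fibre x (θX z) hxz z rfl
    exact ⟨θY w, hx rfl, hw⟩

end Captures

/-- A lattice of open evaluation maps on `X` yields a lattice of semi-open evaluation maps on every
space that is co-absolute with `X`. -/
theorem exists_semiOpen_lattice {X Y : Type u} [TopologicalSpace X] [TopologicalSpace Y]
    [T35Space X] [T35Space Y] (hXY : CoAbsolute Y X) {𝒢 : Set (Set C(X, ℝ))}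
    (h𝒢 : IsSetLattice 𝒢) (hopen : ∀ K ∈ 𝒢, OpenEval K) :
    ∃ ℋ : Set (Set C(Y, ℝ)), IsSetLattice ℋ ∧ ∀ H ∈ ℋ, SemiOpenEval H := by
  -- a set of functions on `Y` belongs to the new lattice if it has a partner in `𝒢` with which it
  -- captures the same open sets; stating this function by function makes it stable under unions
  obtain ⟨Z, _, θY, θX, ⟨_, _, hθY, hirrY⟩, ⟨-, -, hθX, hirrX⟩⟩ := hXY
  have hX : CountableChainCondition X := countableChainCondition_of_lattice h𝒢 hopen
  have hY : CountableChainCondition Y :=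
    (hX.of_irreducible hθX.isClosedMap hirrX).image hθY.continuous hirrY.1
  choose N hNc hN using exists_countable_captures (θY := θY) hX hθY.continuous hθX.continuous
    hθX.isClosedMap hirrX
  choose N' hNc' hN' using exists_countable_captures (θY := θX) hY hθX.continuous hθY.continuous
    hθY.isClosedMap hirrY
  refine ⟨{H | ∃ K ∈ 𝒢, (∀ g ∈ H, N g ⊆ K) ∧ ∀ k ∈ K, N' k ⊆ H}, ⟨?_, ?_⟩, ?_⟩
  · intro H hH
    -- close off in the disjoint union of `C(Y, ℝ)` and `C(X, ℝ)`
    have hlat : IsSetLattice {M : Set (C(Y, ℝ) ⊕ C(X, ℝ)) | Sum.inr ⁻¹' M ∈ 𝒢} := by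
      refine ⟨fun M hM => ?_, fun 𝒜 h𝒜 => ?_⟩
      · obtain ⟨K, hK, hKc, hMK⟩ := h𝒢.cofinal (Sum.inr ⁻¹' M)
          (hM.preimage Sum.inr_injective)
        refine ⟨Sum.inl '' (Sum.inl ⁻¹' M) ∪ Sum.inr '' K, ?_,
          ((hM.preimage Sum.inl_injective).image _).union (hKc.image _), ?_⟩
        · have : Sum.inr ⁻¹' (Sum.inl '' (Sum.inl ⁻¹' M) ∪ Sum.inr '' K :
              Set (C(Y, ℝ) ⊕ C(X, ℝ))) = K := by
            ext k
            simp
          rwa [mem_ofPred_eq, this]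
        · rintro (g | k) hm
          · exact Or.inl ⟨g, hm, rfl⟩
          · exact Or.inr ⟨k, hMK hm, rfl⟩
      · have : Sum.inr ⁻¹' ⋃₀ 𝒜 = ⋃₀ ((fun M => Sum.inr ⁻¹' M) '' 𝒜) := by
          ext k
          simp
        rw [mem_ofPred_eq, this]
        refine h𝒢.sUnion_mem _ ?_
        rintro _ ⟨M, hM, rfl⟩
        exact h𝒜 hM
    obtain ⟨M, hM, hMc, hHM, hMN⟩ := hlat.exists_closed
      (fun F => ⋃ m ∈ F, Sum.elim (fun g => Sum.inr '' N g) (fun k => Sum.inl '' N' k) m)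
      (fun F => F.countable_toSet.biUnion (by
        rintro (g | k) -
        · exact (hNc g).image _
        · exact (hNc' k).image _)) (hH.image Sum.inl)
    refine ⟨Sum.inl ⁻¹' M, ⟨Sum.inr ⁻¹' M, hM, fun g hg k hk => ?_, fun k hk g hg => ?_⟩,
      hMc.preimage Sum.inl_injective, fun g hg => hHM ⟨g, hg, rfl⟩⟩
    · exact hMN {Sum.inl g} (by simpa using hg) (by simpa using hk)
    · exact hMN {Sum.inr k} (by simpa using hk) (by simpa using hg)
  · intro 𝒜 h𝒜
    choose! K hK hNK hN'K using h𝒜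
    refine ⟨⋃₀ (K '' 𝒜), h𝒢.sUnion_mem _ (by rintro _ ⟨H, hH, rfl⟩; exact hK hH), ?_, ?_⟩
    · rintro g ⟨H, hH, hg⟩
      exact (hNK hH g hg).trans (subset_sUnion_of_mem ⟨H, hH, rfl⟩)
    · rintro k ⟨_, ⟨H, hH, rfl⟩, hk⟩
      exact (hN'K hH k hk).trans (subset_sUnion_of_mem hH)
  · rintro H ⟨K, hK, hNK, hN'K⟩
    refine semiOpenEval_of_captures hθY.continuous hirrY.1 hθX hirrX (hopen K hK) ?_ ?_
    · exact captures_functionTopology hθY.continuous hθX.continuous (le_functionTopology K)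
        fun g hg => (hN g).mono (functionTopology_anti (hNK g hg))
    · exact captures_functionTopology hθX.continuous hθY.continuous (le_functionTopology H)
        fun k hk => (hN' k).mono (functionTopology_anti (hN'K k hk))

/-! ### Continuous functions on products of second countable spaces -/

section Products

variable {ι Q : Type*}

open Classical in
/-- The point of `ι → Q` that has the coordinates of `y` on `C` and those of `z` elsewhere. -/
noncomputable def glue (C : Set ι) (y : C → Q) (z : ι → Q) (i : ι) : Q :=
  if h : i ∈ C then y ⟨i, h⟩ else z i

theorem glue_of_mem {C : Set ι} (y : C → Q) (z : ι → Q) {i : ι} (h : i ∈ C) :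
    glue C y z i = y ⟨i, h⟩ := dif_pos h

theorem glue_of_notMem {C : Set ι} (y : C → Q) (z : ι → Q) {i : ι} (h : i ∉ C) :
    glue C y z i = z i := dif_neg h

theorem continuous_glue [TopologicalSpace Q] (C : Set ι) (z : ι → Q) :
    Continuous fun y : C → Q => glue C y z := by
  refine continuous_pi fun i => ?_
  by_cases h : i ∈ C
  · simpa only [glue_of_mem _ _ h] using continuous_apply _
  · simpa only [glue_of_notMem _ _ h] using continuous_const

variable [TopologicalSpace Q] [SecondCountableTopology Q]

theorem exists_mem_countableBasis {X : Type*} [TopologicalSpace X] [SecondCountableTopology X]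
    {O : Set X} (hO : IsOpen O) {x : X} (hx : x ∈ O) : ∃ b ∈ countableBasis X, x ∈ b ∧ b ⊆ O :=
  (isBasis_countableBasis X).exists_subset_of_mem_open hx hO

/-- A continuous real function `g` on a product of second countable spaces depends on countably many
coordinates.  The set `C` of coordinates is such that whenever `g < r` somewhere on a basic open set
with support in `C`, the inequality is forced at some point of it by finitely many coordinates
in `C`. -/
theorem exists_countable_dependsOn {g : (ι → Q) → ℝ} (hg : Continuous g) :
    ∃ C : Set ι, C.Countable ∧ ∀ z z' : ι → Q, (∀ i ∈ C, z i = z' i) → g z = g z' := by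
  classical
  let t : Finset ι → TopologicalSpace (ι → Q) :=
    fun F => induced (fun z (i : F) => z i) inferInstance
  have ht : ∀ F, @SecondCountableTopology _ (t F) := fun F => secondCountableTopology_induced _ _ _
  have hch : ∀ (b : Set (ι → Q)) (r : ℚ), ∃ I : Finset ι, (∃ z ∈ b, g z < r) →
      ∃ z ∈ b, ∀ w : ι → Q, (∀ i ∈ I, w i = z i) → g w < r := by
    intro b r
    by_cases h : ∃ z ∈ b, g z < r
    · obtain ⟨z, hz, hzr⟩ := h
      obtain ⟨I, u, hu, hI⟩ := isOpen_pi_iff.1 (isOpen_Iio.preimage hg) z hzr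
      exact ⟨I, fun _ => ⟨z, hz, fun w hw => hI fun i hi => (hw i hi) ▸ (hu i hi).2⟩⟩
    · exact ⟨∅, fun h' => absurd h' h⟩
  choose I hI using hch
  obtain ⟨C, -, hC, -, hCN⟩ := isSetLattice_univ.exists_closed
    (fun F => ⋃ b ∈ @countableBasis _ (t F) (ht F), ⋃ r : ℚ, (I b r : Set ι))
    (fun F => (@countable_countableBasis _ (t F) (ht F)).biUnion fun b _ =>
      countable_iUnion fun r => (I b r).countable_toSet) countable_empty
  have key : ∀ z z' : ι → Q, (∀ i ∈ C, z i = z' i) → ¬ g z < g z' := by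
    intro z z' hzz' hlt
    obtain ⟨r, hzr, hrz'⟩ := exists_rat_btwn hlt
    obtain ⟨J, u, hu, hJ⟩ := isOpen_pi_iff.1 (isOpen_Ioi.preimage hg) z' hrz'
    let F := J.filter (· ∈ C)
    have hO : IsOpen[t F] {w | ∀ i ∈ F, w i ∈ u i} := by
      have : {w : ι → Q | ∀ i ∈ F, w i ∈ u i} =
          ⋂ i : F, (fun w (i : F) => w i.1) ⁻¹' ((fun v : F → Q => v i) ⁻¹' u i) := by
        ext w
        simp
      rw [this]
      refine @isOpen_iInter_of_finite _ _ (t F) _ _ fun i => isOpen_induced ?_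
      exact (hu i.1 (Finset.mem_filter.1 i.2).1).1.preimage (continuous_apply i)
    obtain ⟨b, hb, hzb, hbO⟩ :=
      @exists_mem_countableBasis _ (t F) (ht F) _ hO z fun i hi => by
        rw [hzz' i (Finset.mem_filter.1 hi).2]
        exact (hu i (Finset.mem_filter.1 hi).1).2
    obtain ⟨z₁, hz₁, hw⟩ := hI b r ⟨z, hzb, hzr⟩
    have hIC : (I b r : Set ι) ⊆ C :=
      ((subset_iUnion (fun r => (I b r : Set ι)) r).trans
        (subset_biUnion_of_mem (u := fun b => ⋃ r : ℚ, (I b r : Set ι)) hb)).trans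
        (hCN F fun i hi => (Finset.mem_filter.1 hi).2)
    -- `z₁` on `C` and `z'` elsewhere: both inequalities hold there
    have h₁ := hw (fun i => if i ∈ C then z₁ i else z' i) fun i hi => if_pos (hIC hi)
    have h₂ : (r : ℝ) < g fun i => if i ∈ C then z₁ i else z' i := by
      refine hJ fun i hi => ?_
      by_cases hiC : i ∈ C
      · simpa [hiC] using hbO hz₁ i (Finset.mem_filter.2 ⟨hi, hiC⟩)
      · simpa [hiC] using (hu i hi).2
    exact lt_asymm h₁ h₂
  exact ⟨C, hC, fun z z' h => le_antisymm (not_lt.1 (key z' z fun i hi => (h i hi).symm))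
    (not_lt.1 (key z z' h))⟩

/-- For every open cover of a zero-dimensional second countable space, members of the cover that
contain the given points can be chosen locally constantly. -/
theorem exists_locallyConstant_selector {Y : Type*} [TopologicalSpace Y]
    [SecondCountableTopology Y] (hY : ∀ (y : Y) (U : Set Y), IsOpen U → y ∈ U →
      ∃ V, IsClopen V ∧ y ∈ V ∧ V ⊆ U) {κ : Type*} {U : κ → Set Y} (hU : ∀ i, IsOpen (U i))
    (hcov : ⋃ i, U i = univ) :
    ∃ σ : Y → κ, (∀ y, y ∈ U (σ y)) ∧ ∀ S : Set κ, IsClopen (σ ⁻¹' S) := by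
  classical
  rcases isEmpty_or_nonempty Y with hE | hE
  · exact ⟨fun y => isEmptyElim y, fun y => isEmptyElim y, fun S => by
      rw [eq_empty_of_isEmpty (_ ⁻¹' S)]
      exact isClopen_empty⟩
  have hsel : ∀ y, ∃ i, ∃ V, IsClopen V ∧ y ∈ V ∧ V ⊆ U i := by
    intro y
    obtain ⟨i, hi⟩ := mem_iUnion.1 (hcov ▸ mem_univ y)
    exact ⟨i, hY y (U i) (hU i) hi⟩
  choose i V hV hyV hVU using hsel
  obtain ⟨s, hs, hsV⟩ := TopologicalSpace.countable_cover_nhds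
    fun y => (hV y).isOpen.mem_nhds (hyV y)
  have hsne : s.Nonempty := by
    by_contra h
    rw [not_nonempty_iff_eq_empty] at h
    rw [h, biUnion_empty] at hsV
    exact empty_ne_univ hsV
  obtain ⟨y, rfl⟩ := hs.exists_eq_range hsne
  have hex : ∀ x, ∃ k, x ∈ V (y k) := by
    intro x
    have : x ∈ ⋃ w ∈ range y, V w := hsV ▸ mem_univ x
    simpa using this
  have hcont : Continuous fun x => Nat.find (hex x) := by
    refine continuous_discrete_rng.2 fun k => ?_
    have : (fun x => Nat.find (hex x)) ⁻¹' {k} = V (y k) ∩ ⋂ j ∈ Finset.range k, (V (y j))ᶜ := by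
      ext x
      simp [Nat.find_eq_iff]
    rw [this]
    exact (hV _).isOpen.inter (isOpen_biInter_finset fun j _ => (hV _).compl.isOpen)
  exact ⟨fun x => i (y (Nat.find (hex x))), fun x => hVU _ (Nat.find_spec (hex x)),
    fun S => (isClopen_discrete ((fun k => i (y k)) ⁻¹' S)).preimage hcont⟩

/-- Arbitrary products of zero-dimensional second countable spaces have covering dimension zero. -/
theorem dimLEZero_pi (hQ : ∀ (x : Q) (U : Set Q), IsOpen U → x ∈ U →
    ∃ V, IsClopen V ∧ x ∈ V ∧ V ⊆ U) [Nonempty Q] : DimLEZero (ι → Q) := by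
  classical
  intro n U hU hcov
  choose g hg using hU
  choose C hC hgC using fun i => exists_countable_dependsOn (g i).continuous
  let D : Set ι := ⋃ i, C i
  have : Countable D := (countable_iUnion hC).to_subtype
  let z₀ : ι → Q := fun _ => Classical.arbitrary Q
  have hglue : ∀ (i : Fin n) (z : ι → Q), g i (glue D (fun c => z c) z₀) = g i z := fun i z =>
    hgC i _ _ fun c hc => glue_of_mem _ _ (mem_iUnion.2 ⟨i, hc⟩)
  obtain ⟨σ, hσ, hσc⟩ := exists_locallyConstant_selector (Y := D → Q) (κ := Fin n)
    (U := fun i => {y | g i (glue D y z₀) ≠ 0}) (fun y W hW hy => by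
      obtain ⟨J, u, hu, hJ⟩ := isOpen_pi_iff.1 hW y hy
      choose! V hV hyV hVu using fun c hc => hQ (y c) (u c) (hu c hc).1 (hu c hc).2
      refine ⟨⋂ c ∈ J, (fun w => w c) ⁻¹' V c,
        isClopen_biInter_finset fun c hc => (hV c hc).preimage (continuous_apply c), ?_, ?_⟩
      · simpa using fun c hc hcJ => hyV ⟨c, hc⟩ hcJ
      · intro w hw
        refine hJ fun c hc => hVu c hc ?_
        exact mem_iInter₂.1 hw c hc)
    (fun i => isOpen_ne_fun ((g i).continuous.comp (continuous_glue D z₀)) continuous_const)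
    (by
      refine eq_univ_of_forall fun y => ?_
      obtain ⟨i, hi⟩ := mem_iUnion.1 (hcov ▸ mem_univ (glue D y z₀))
      rw [hg i] at hi
      exact mem_iUnion.2 ⟨i, hi⟩)
  have hcont : Continuous fun (z : ι → Q) (c : D) => z c := by fun_prop
  refine ⟨fun i => (fun z (c : D) => z c) ⁻¹' (σ ⁻¹' {i}), fun i => (hσc {i}).preimage hcont,
    ?_, ?_, ?_⟩
  · rintro i z rfl
    have := hσ fun c : D => z c
    rw [mem_ofPred_eq, hglue] at this
    rwa [hg]
  · intro i j hij
    refine disjoint_left.2 ?_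
    rintro z rfl hz
    exact hij hz
  · exact eq_univ_of_forall fun z => mem_iUnion.2 ⟨σ fun c => z c, rfl⟩

end Products

/-! ### An open map of a zero-dimensional space onto the line -/

/-- Pairs of irrational numbers. -/
abbrev IrrationalPair : Type := {x : ℝ // Irrational x} × {x : ℝ // Irrational x}

/-- The sum of two irrational numbers. -/
def IrrationalPair.sum (x : IrrationalPair) : ℝ := x.1 + x.2

theorem IrrationalPair.continuous_sum : Continuous IrrationalPair.sum := by
  unfold IrrationalPair.sum
  fun_prop

theorem exists_irrational_add_eq {U V : Set ℝ} (hU : IsOpen U) (hV : IsOpen V) {a b : ℝ}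
    (ha : a ∈ U) (hb : b ∈ V) :
    ∃ x ∈ U, ∃ y ∈ V, Irrational x ∧ Irrational y ∧ x + y = a + b := by
  have hc : (range ((↑) : ℚ → ℝ) ∪ (fun x => a + b - x) ⁻¹' range ((↑) : ℚ → ℝ)).Countable :=
    (countable_range _).union ((countable_range _).preimage (sub_right_injective))
  have hO : IsOpen (U ∩ (fun x => a + b - x) ⁻¹' V) :=
    hU.inter (hV.preimage (continuous_const.sub continuous_id))
  obtain ⟨x, ⟨hxU, hxV⟩, hx⟩ := (hc.dense_compl ℝ).inter_open_nonempty _ hO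
    ⟨a, ha, by simpa using hb⟩
  exact ⟨x, hxU, a + b - x, hxV, fun h => hx (Or.inl h), fun h => hx (Or.inr h), by ring⟩

theorem IrrationalPair.surjective_sum : Function.Surjective IrrationalPair.sum := by
  intro t
  obtain ⟨x, -, y, -, hx, hy, h⟩ :=
    exists_irrational_add_eq isOpen_univ isOpen_univ (mem_univ t) (mem_univ 0)
  exact ⟨⟨⟨x, hx⟩, ⟨y, hy⟩⟩, by simpa [IrrationalPair.sum] using h⟩

open scoped Pointwise in
/-- Addition remains open when both summands are restricted to the irrational numbers. -/
theorem IrrationalPair.isOpenMap_sum : IsOpenMap IrrationalPair.sum := by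
  intro W hW
  refine isOpen_iff_mem_nhds.2 ?_
  rintro _ ⟨⟨a, b⟩, hab, rfl⟩
  obtain ⟨U, V, hU, hV, ha, hb, hUV⟩ := isOpen_prod_iff.1 hW a b hab
  obtain ⟨U', hU', rfl⟩ := isOpen_induced_iff.1 hU
  obtain ⟨V', hV', rfl⟩ := isOpen_induced_iff.1 hV
  have hO : IsOpen (U' + V') := hU'.add_right
  refine Filter.mem_of_superset (hO.mem_nhds (add_mem_add ha hb)) ?_
  rintro _ ⟨u, hu, v, hv, rfl⟩
  obtain ⟨x, hxU, y, hyV, hx, hy, h⟩ := exists_irrational_add_eq hU' hV' hu hv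
  exact ⟨⟨⟨x, hx⟩, ⟨y, hy⟩⟩, hUV ⟨hxU, hyV⟩, h⟩

theorem exists_isClopen_irrational (x : {x : ℝ // Irrational x}) {U : Set {x : ℝ // Irrational x}}
    (hU : IsOpen U) (hx : x ∈ U) : ∃ V, IsClopen V ∧ x ∈ V ∧ V ⊆ U := by
  obtain ⟨U', hU', rfl⟩ := isOpen_induced_iff.1 hU
  obtain ⟨ε, hε, hb⟩ := Metric.isOpen_iff.1 hU' x.1 hx
  obtain ⟨p, hp, hpx⟩ := exists_rat_btwn (sub_lt_self x.1 hε)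
  obtain ⟨r, hxr, hr⟩ := exists_rat_btwn (lt_add_of_pos_right x.1 hε)
  have he : (Subtype.val ⁻¹' Icc (p : ℝ) r : Set {x : ℝ // Irrational x}) =
      Subtype.val ⁻¹' Ioo (p : ℝ) r := by
    ext y
    simp only [mem_preimage, mem_Icc, mem_Ioo]
    exact ⟨fun h => ⟨h.1.lt_of_ne' (y.2.ne_rat p), h.2.lt_of_ne (y.2.ne_rat r)⟩,
      fun h => ⟨h.1.le, h.2.le⟩⟩
  refine ⟨Subtype.val ⁻¹' Ioo (p : ℝ) r, ⟨?_, isOpen_Ioo.preimage continuous_subtype_val⟩,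
    ⟨hpx, hxr⟩, fun y hy => hb ?_⟩
  · rw [← he]
    exact isClosed_Icc.preimage continuous_subtype_val
  · rw [Real.ball_eq_Ioo]
    exact ⟨hp.trans hy.1, hy.2.trans hr⟩

theorem IrrationalPair.exists_isClopen (x : IrrationalPair) (U : Set IrrationalPair)
    (hU : IsOpen U) (hx : x ∈ U) : ∃ V, IsClopen V ∧ x ∈ V ∧ V ⊆ U := by
  obtain ⟨U₁, U₂, hU₁, hU₂, hx₁, hx₂, hs⟩ := isOpen_prod_iff.1 hU x.1 x.2 hx
  obtain ⟨V₁, hV₁, hxV₁, hVU₁⟩ := exists_isClopen_irrational x.1 hU₁ hx₁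
  obtain ⟨V₂, hV₂, hxV₂, hVU₂⟩ := exists_isClopen_irrational x.2 hU₂ hx₂
  exact ⟨V₁ ×ˢ V₂, hV₁.prod hV₂, ⟨hxV₁, hxV₂⟩, (prod_mono hVU₁ hVU₂).trans hs⟩

/-! ### AE(0)-spaces -/

section AEZero

theorem isInducing_evalMap_univ {X : Type*} [TopologicalSpace X] [CompletelyRegularSpace X] :
    IsInducing (evalMap (univ : Set C(X, ℝ))) := by
  refine ⟨(le_functionTopology univ).antisymm fun U hU => ?_⟩
  refine (@isOpen_iff_forall_mem_open X (functionTopology univ) U).2 fun x hx => ?_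
  obtain ⟨g, hgx, hg⟩ := exists_cozero_subset hU hx
  exact ⟨_, hg, isOpen_functionTopology_ne_zero (mem_univ g), hgx⟩

theorem evalMap_univ_injective {X : Type*} [TopologicalSpace X] [T35Space X] :
    Function.Injective (evalMap (univ : Set C(X, ℝ))) :=
  isInducing_evalMap_univ.injective

/-- An AE(0)-space `X` has a lattice of open evaluation maps.  The embedding `X → ℝ^C(X, ℝ)` makes
every continuous function on `X` a coordinate, so the partial map from the zero-dimensional space
`IrrationalPair^C(X, ℝ)` to `X` that covers it satisfies the hypothesis of the extension property,
and extends to a map `F`.  The lattice consists of the sets `C` such that the coordinates of `F` in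
`C` depend only on the coordinates of the argument in `C`. -/
theorem IsAEZero.exists_open_lattice {X : Type u} [TopologicalSpace X] [T35Space X]
    (hX : IsAEZero X) :
    ∃ 𝒢 : Set (Set C(X, ℝ)), IsSetLattice 𝒢 ∧ ∀ C ∈ 𝒢, OpenEval C := by
  classical
  have hne : Nonempty IrrationalPair := ⟨(IrrationalPair.surjective_sum 0).choose⟩
  obtain ⟨F, hF⟩ : ∃ F : C(C(X, ℝ) → IrrationalPair, X),
      ∀ z x, (∀ a : C(X, ℝ), (z a).sum = a x) → F z = x := by
    let Z₀ : Set (C(X, ℝ) → IrrationalPair) := {z | ∃ x, ∀ a : C(X, ℝ), (z a).sum = a x}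
    choose f hf using fun z : Z₀ => z.2
    have hfc : Continuous f := by
      refine isInducing_evalMap_univ.continuous_iff.2 (continuous_pi fun a => ?_)
      have : (fun z : Z₀ => a.1 (f z)) = fun z : Z₀ => (z.1 a.1).sum :=
        funext fun z => (hf z a.1).symm
      change Continuous fun z : Z₀ => a.1 (f z)
      rw [this]
      exact IrrationalPair.continuous_sum.comp
        ((continuous_apply a.1).comp continuous_subtype_val)
    obtain ⟨F, hF⟩ := hX (C(X, ℝ) → IrrationalPair)
      (dimLEZero_pi IrrationalPair.exists_isClopen) Z₀ ⟨f, hfc⟩ fun g =>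
        ⟨⟨fun z => (z g).sum, IrrationalPair.continuous_sum.comp (continuous_apply g)⟩,
          fun z => hf z g⟩
    refine ⟨F, fun z x hzx => ?_⟩
    rw [hF ⟨z, x, hzx⟩]
    refine evalMap_univ_injective (funext fun a => ?_)
    exact (hf ⟨z, x, hzx⟩ a.1).symm.trans (hzx a.1)
  choose D hD hFD using fun a : C(X, ℝ) =>
    exists_countable_dependsOn (a.continuous.comp F.continuous)
  refine ⟨{C | ∀ a ∈ C, D a ⊆ C}, ⟨fun H hH => ?_, fun 𝒜 h𝒜 a ha => ?_⟩, fun C hC U hU => ?_⟩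
  · obtain ⟨C, -, hCc, hHC, hC⟩ := isSetLattice_univ.exists_closed
      (fun S : Finset C(X, ℝ) => ⋃ a ∈ S, D a)
      (fun S => S.countable_toSet.biUnion fun a _ => hD a) hH
    refine ⟨C, fun a ha => ?_, hCc, hHC⟩
    simpa using hC {a} (by simpa using ha)
  · obtain ⟨C, hC, haC⟩ := ha
    exact (h𝒜 hC a haC).trans (subset_sUnion_of_mem hC)
  · -- lift along the open map of the products and apply `F`
    refine (@isOpen_iff_forall_mem_open X (functionTopology C) _).2 fun x hx => ?_
    obtain ⟨x₀, hx₀, hxx₀⟩ := hx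
    choose z₀ hz₀ using fun a : C(X, ℝ) => IrrationalPair.surjective_sum (a x₀)
    let O : Set (C → IrrationalPair) := {w | F (glue C w z₀) ∈ U}
    have hO : IsOpen O := hU.preimage (F.continuous.comp (continuous_glue C z₀))
    have hO' := (IsOpenMap.piMap (f := fun (_ : C) => IrrationalPair.sum)
      (fun _ => IrrationalPair.isOpenMap_sum)
      (Filter.Eventually.of_forall fun _ => IrrationalPair.surjective_sum)) O hO
    refine ⟨evalMap C ⁻¹' _, ?_, isOpen_induced hO', ?_⟩
    · rintro y ⟨w, hw, hwy⟩
      refine ⟨F (glue C w z₀), hw, fun a ha => ?_⟩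
      choose z₁ hz₁ using fun a : C(X, ℝ) => IrrationalPair.surjective_sum (a y)
      have hFy : F (glue C w z₁) = y := by
        refine hF _ _ fun b => ?_
        by_cases hb : b ∈ C
        · rw [glue_of_mem _ _ hb]
          exact congrFun hwy ⟨b, hb⟩
        · rw [glue_of_notMem _ _ hb, hz₁]
      calc a y = a (F (glue C w z₁)) := by rw [hFy]
        _ = a (F (glue C w z₀)) := hFD a _ _ fun b hb => by
          rw [glue_of_mem _ _ (hC a ha hb), glue_of_mem _ _ (hC a ha hb)]
    · refine ⟨fun c => z₀ c, ?_, funext fun c => ?_⟩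
      · have : glue C (fun c => z₀ c) z₀ = z₀ := by
          funext i
          by_cases hi : i ∈ C
          · rw [glue_of_mem _ _ hi]
          · rw [glue_of_notMem _ _ hi]
        change F (glue C (fun c => z₀ c) z₀) ∈ U
        rwa [this, hF z₀ x₀ hz₀]
      · exact (hz₀ c.1).trans (hxx₀ c.1 c.2).symm

end AEZero

/-! ### Weight and real functions -/

/-- A completely regular space carries the topology of at most `weight T` real functions: one for
each pair of basic sets that a cozero set can be put between. -/
theorem exists_functionTopology_eq (T : Type u) [t : TopologicalSpace T]
    [CompletelyRegularSpace T] :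
    ∃ H : Set C(T, ℝ), #H ≤ weight T ∧ functionTopology H = t := by
  classical
  obtain ⟨B, hB, hBw⟩ : ∃ B : Set (Set T), IsTopologicalBasis B ∧
      #B = sInf {κ | ∃ B : Set (Set T), IsTopologicalBasis B ∧ #B = κ} :=
    csInf_mem (s := {κ | ∃ B : Set (Set T), IsTopologicalBasis B ∧ #B = κ})
      ⟨_, _, isTopologicalBasis_opens, rfl⟩
  have hw : #B ≤ weight T := hBw.trans_le (le_max_right _ _)
  have hch : ∀ p : B × B, ∃ h : C(T, ℝ),
      (∃ g : C(T, ℝ), p.1.1 ⊆ {x | g x ≠ 0} ∧ {x | g x ≠ 0} ⊆ p.2.1) →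
        p.1.1 ⊆ {x | h x ≠ 0} ∧ {x | h x ≠ 0} ⊆ p.2.1 := by
    intro p
    by_cases h : ∃ g : C(T, ℝ), p.1.1 ⊆ {x | g x ≠ 0} ∧ {x | g x ≠ 0} ⊆ p.2.1
    · exact ⟨h.choose, fun _ => h.choose_spec⟩
    · exact ⟨0, fun h' => absurd h' h⟩
  choose h hh using hch
  refine ⟨range h, ?_, le_antisymm (fun U hU => ?_) (le_functionTopology _)⟩
  · calc #(range h) ≤ #(B × B) := Cardinal.mk_range_le
      _ = #B * #B := by simp
      _ ≤ weight T * weight T := mul_le_mul' hw hw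
      _ = weight T := Cardinal.mul_eq_self (le_max_left _ _)
  · refine (@isOpen_iff_forall_mem_open T (functionTopology (range h)) U).2 fun x hx => ?_
    obtain ⟨b₂, hb₂, hxb₂, hb₂U⟩ := hB.exists_subset_of_mem_open hx hU
    obtain ⟨g, hgx, hg⟩ := exists_cozero_subset (hB.isOpen hb₂) hxb₂
    obtain ⟨b₁, hb₁, hxb₁, hb₁g⟩ := hB.exists_subset_of_mem_open
      (show x ∈ {x | g x ≠ 0} from hgx) (isOpen_ne_fun g.continuous continuous_const)
    obtain ⟨h₁, h₂⟩ := hh (⟨b₁, hb₁⟩, ⟨b₂, hb₂⟩) ⟨g, hb₁g, hg⟩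
    exact ⟨_, h₂.trans hb₂U, isOpen_functionTopology_ne_zero ⟨_, rfl⟩, h₁ hxb₁⟩

theorem weight_le_of_functionTopology_eq {T : Type u} [t : TopologicalSpace T] {H : Set C(T, ℝ)}
    (hH : functionTopology H = t) : weight T ≤ max ℵ₀ #H := by
  classical
  let s : Finset H → TopologicalSpace T := fun F =>
    functionTopology (Subtype.val '' (F : Set H) : Set C(T, ℝ))
  have hs : ∀ F, @SecondCountableTopology T (s F) := fun F =>
    secondCountableTopology_functionTopology (F.countable_toSet.image _)
  let B : Set (Set T) := ⋃ F : Finset H, @countableBasis T (s F) (hs F)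
  have hB : IsTopologicalBasis B := by
    refine isTopologicalBasis_of_isOpen_of_nhds ?_ ?_
    · intro b hb
      obtain ⟨F, hb⟩ := mem_iUnion.1 hb
      exact le_functionTopology _ _ (@isOpen_of_mem_countableBasis T (s F) (hs F) b hb)
    · intro x U hx hU
      rw [← hH] at hU
      obtain ⟨F, hF, O, hO, hxO, hOU⟩ := exists_finset_isOpen_functionTopology hU hx
      have hO' : IsOpen[s (F.subtype (· ∈ H))] O := by
        refine functionTopology_anti ?_ O hO
        intro g hg
        exact ⟨⟨g, hF hg⟩, by simpa using hg, rfl⟩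
      obtain ⟨b, hb, hxb, hbO⟩ := @exists_mem_countableBasis T (s _) (hs _) O hO' x hxO
      exact ⟨b, mem_iUnion.2 ⟨_, hb⟩, hxb, hbO.trans hOU⟩
  have hcard : #B ≤ max ℵ₀ #H := by
    have hfin : #(Finset H) ≤ max ℵ₀ #H :=
      (Cardinal.mk_le_of_surjective (List.toFinset_surjective (α := H))).trans
        (Cardinal.mk_list_le_max _)
    calc #B ≤ #(Finset H) * ⨆ F : Finset H, #(@countableBasis T (s F) (hs F)) :=
          Cardinal.mk_iUnion_le _
      _ ≤ max ℵ₀ #H * max ℵ₀ #H := mul_le_mul' hfin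
          ((ciSup_le' fun F => (@countable_countableBasis T (s F) (hs F)).le_aleph0).trans
            (le_max_left _ _))
      _ = max ℵ₀ #H := Cardinal.mul_eq_self (le_max_left _ _)
  have hinf := csInf_le' (s := {κ | ∃ B : Set (Set T), IsTopologicalBasis B ∧ #B = κ})
    ⟨B, hB, rfl⟩
  exact max_le (le_max_left _ _) (hinf.trans hcard)

/-! ### Multiplicative lattices and lattices of sets of functions -/

section Lattices

variable {X : Type u} [TopologicalSpace X]

/-- The topology on `X` pulled back from the image of a map; it determines the map up to a
homeomorphism of images. -/
abbrev MapOnto.topology (φ : MapOnto X) : TopologicalSpace X :=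
  induced φ.toFun inferInstance

theorem MapOnto.precedes_of_topology_le {φ f : MapOnto X} (h : φ.topology ≤ f.topology) :
    φ.Precedes f := by
  have hpre : ∀ O : Set f.image, IsOpen O →
      ∃ V : Set φ.image, IsOpen V ∧ φ.toFun ⁻¹' V = f.toFun ⁻¹' O := fun O hO =>
    isOpen_induced_iff.1 (h _ (isOpen_induced hO))
  have heq : ∀ x y, φ.toFun x = φ.toFun y → f.toFun x = f.toFun y := by
    intro x y hxy
    refine Inseparable.eq (inseparable_iff_forall_isOpen.2 fun O hO => ?_)
    obtain ⟨V, -, hV⟩ := hpre O hO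
    rw [← mem_preimage, ← mem_preimage, ← hV, mem_preimage, mem_preimage, hxy]
  have hg : ∀ x, f.toFun x = f.toFun (Function.surjInv φ.surj (φ.toFun x)) := fun x =>
    heq _ _ (Function.surjInv_eq φ.surj _).symm
  refine ⟨fun s => f.toFun (Function.surjInv φ.surj s), continuous_def.2 fun O hO => ?_, hg⟩
  obtain ⟨V, hVo, hV⟩ := hpre O hO
  convert hVo
  ext s
  obtain ⟨x, rfl⟩ := φ.surj s
  rw [mem_preimage, ← hg, ← mem_preimage, ← hV, mem_preimage]

theorem MapOnto.Precedes.topology_le {φ f : MapOnto X} (h : φ.Precedes f) :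
    φ.topology ≤ f.topology := by
  obtain ⟨g, hg, hfg⟩ := h
  have : f.toFun = g ∘ φ.toFun := funext hfg
  rw [MapOnto.topology, MapOnto.topology, this, ← induced_compose]
  exact induced_mono (continuous_iff_le_induced.1 hg)

theorem induced_rangeFactorization {A T : Type*} [TopologicalSpace T] (f : A → T) :
    induced (rangeFactorization f) inferInstance = induced f inferInstance :=
  induced_compose

theorem MapOnto.topology_diagonal {A : Type u} (φ : A → MapOnto X) :
    (MapOnto.diagonal φ).topology = ⨅ a, (φ a).topology := by
  refine (induced_rangeFactorization _).trans ?_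
  rw [Pi.topologicalSpace, induced_iInf]
  simp only [induced_compose]
  rfl

theorem MapOnto.Same.topology_eq {φ ψ : MapOnto X} (h : φ.Same ψ) : φ.topology = ψ.topology := by
  obtain ⟨h, hh⟩ := h
  have : ψ.toFun = h ∘ φ.toFun := funext fun x => (hh x).symm
  rw [MapOnto.topology, MapOnto.topology, this, ← induced_compose, ← h.isInducing.eq_induced]

/-- The evaluation map of a set of functions, as a map onto its image. -/
def MapOnto.ofFunctions (H : Set C(X, ℝ)) : MapOnto X where
  image := range (evalMap H)
  toFun := rangeFactorization (evalMap H)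
  cont := (continuous_evalMap H).subtype_mk _
  surj := rangeFactorization_surjective

theorem MapOnto.topology_ofFunctions (H : Set C(X, ℝ)) :
    (MapOnto.ofFunctions H).topology = functionTopology H :=
  induced_rangeFactorization _

theorem MapOnto.weight_ofFunctions_le (H : Set C(X, ℝ)) :
    weight (MapOnto.ofFunctions H).image ≤ max ℵ₀ #H := by
  let c : H → C(range (evalMap H), ℝ) := fun h =>
    ⟨fun s => s.1 h, (continuous_apply h).comp continuous_subtype_val⟩
  have hc : functionTopology (range c) =
      (inferInstance : TopologicalSpace (range (evalMap H))) := by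
    change _ = induced Subtype.val (⨅ h : H, induced (fun v : H → ℝ => v h) inferInstance)
    rw [functionTopology_eq_iInf, iInf_range, induced_iInf]
    simp only [induced_compose]
    rfl
  exact (weight_le_of_functionTopology_eq hc).trans (max_le_max_left _ Cardinal.mk_range_le)

theorem MapOnto.eq_iff_of_topology_eq {φ : MapOnto X} {H : Set C(X, ℝ)}
    (h : φ.topology = functionTopology H) {x y : X} :
    φ.toFun x = φ.toFun y ↔ ∀ g ∈ H, g x = g y := by
  have h₁ := @IsInducing.inseparable_iff X φ.image φ.topology _ x y φ.toFun (.induced _)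
  have h₂ := @IsInducing.inseparable_iff X (H → ℝ) (functionTopology H) _ x y (evalMap H)
    (.induced _)
  rw [← inseparable_iff_eq, h₁, h, ← h₂, inseparable_iff_eq]
  exact ⟨fun e g hg => congrFun e ⟨g, hg⟩, fun e => funext fun g => e g.1 g.2⟩

theorem functionTopology_image_comp {T : Type*} [TopologicalSpace T] (φ : C(X, T))
    (H : Set C(T, ℝ)) :
    functionTopology ((fun h => h.comp φ) '' H) = induced φ (functionTopology H) := by
  rw [functionTopology_eq_iInf, functionTopology_eq_iInf, iInf_image]
  simp only [induced_iInf, induced_compose]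
  rfl

/-- A multiplicative lattice of open maps gives a lattice of open evaluation maps. -/
theorem HasLatticeOfOpenMaps.exists_open_lattice (h : HasLatticeOfOpenMaps X) :
    ∃ 𝒢 : Set (Set C(X, ℝ)), IsSetLattice 𝒢 ∧ ∀ H ∈ 𝒢, OpenEval H := by
  obtain ⟨Ψ, ⟨hf, hd⟩, ho⟩ := h
  refine ⟨{H | ∃ φ ∈ Ψ, φ.topology = functionTopology H}, ⟨fun H hH => ?_, fun 𝒜 h𝒜 => ?_⟩, ?_⟩
  · obtain ⟨φ, hφ, hprec, hw⟩ := hf (MapOnto.ofFunctions H)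
    obtain ⟨K, hK, hKt⟩ := exists_functionTopology_eq φ.image
    have hKc : K.Countable := by
      rw [← Cardinal.le_aleph0_iff_set_countable]
      exact hK.trans (hw.trans ((MapOnto.weight_ofFunctions_le H).trans
        (max_le le_rfl hH.le_aleph0)))
    have hle := hprec.topology_le
    rw [MapOnto.topology_ofFunctions] at hle
    have hKφ : functionTopology ((fun h => h.comp ⟨φ.toFun, φ.cont⟩) '' K) = φ.topology := by
      rw [functionTopology_image_comp, hKt]
      rfl
    refine ⟨H ∪ (fun h => h.comp ⟨φ.toFun, φ.cont⟩) '' K, ⟨φ, hφ, le_antisymm ?_ ?_⟩,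
      hH.union (hKc.image _), subset_union_left⟩
    · rw [functionTopology_eq_iInf]
      refine le_iInf₂ fun g hg => ?_
      rcases hg with hg | hg
      · exact hle.trans (functionTopology_le_induced hg)
      · exact hKφ.symm.trans_le (functionTopology_le_induced hg)
    · exact (functionTopology_anti subset_union_right).trans_eq hKφ
  · choose φ hφ hφt using fun H : 𝒜 => h𝒜 H.2
    obtain ⟨ψ, hψ, hs⟩ := hd 𝒜 φ hφ
    refine ⟨ψ, hψ, ?_⟩
    rw [hs.topology_eq, MapOnto.topology_diagonal, functionTopology_sUnion, iInf_subtype']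
    exact iInf_congr hφt
  · rintro H ⟨φ, hφ, hφt⟩ U hU
    have : saturation H U = φ.toFun ⁻¹' (φ.toFun '' U) := by
      ext x
      constructor
      · rintro ⟨y, hy, hxy⟩
        exact ⟨y, hy, ((MapOnto.eq_iff_of_topology_eq hφt).2 hxy).symm⟩
      · rintro ⟨y, hy, hxy⟩
        exact ⟨y, hy, (MapOnto.eq_iff_of_topology_eq hφt).1 hxy.symm⟩
    rw [← hφt, this]
    exact isOpen_induced (ho φ hφ U hU)

/-- A lattice of semi-open evaluation maps gives a multiplicative lattice of semi-open maps. -/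
theorem hasLatticeOfSemiOpenMaps_of_lattice {ℋ : Set (Set C(X, ℝ))} (hℋ : IsSetLattice ℋ)
    (hs : ∀ H ∈ ℋ, SemiOpenEval H) : HasLatticeOfSemiOpenMaps X := by
  refine ⟨{φ | ∃ H ∈ ℋ, φ.topology = functionTopology H}, ⟨fun f => ?_, fun A φ hφ => ?_⟩, ?_⟩
  · obtain ⟨K, hK, hKt⟩ := exists_functionTopology_eq f.image
    choose H hH hHc hgH using fun g : C(X, ℝ) => hℋ.cofinal {g} (countable_singleton g)
    let K' : Set C(X, ℝ) := (fun h => h.comp ⟨f.toFun, f.cont⟩) '' K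
    have hK' : #K' ≤ weight f.image := Cardinal.mk_image_le.trans hK
    have hfT : functionTopology K' = f.topology := by
      rw [functionTopology_image_comp, hKt]
      rfl
    have hcard : #(⋃₀ (H '' K') : Set C(X, ℝ)) ≤ weight f.image := by
      rw [sUnion_image, biUnion_eq_iUnion]
      calc #(⋃ g : K', H g : Set C(X, ℝ)) ≤ #K' * ⨆ g : K', #(H g) := Cardinal.mk_iUnion_le _
        _ ≤ weight f.image * weight f.image := mul_le_mul' hK'
          ((ciSup_le' fun g : K' => (hHc g).le_aleph0).trans (le_max_left _ _))
        _ = weight f.image := Cardinal.mul_eq_self (le_max_left _ _)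
    refine ⟨MapOnto.ofFunctions (⋃₀ (H '' K')), ⟨_, hℋ.sUnion_mem _ ?_,
      MapOnto.topology_ofFunctions _⟩, MapOnto.precedes_of_topology_le ?_, ?_⟩
    · rintro _ ⟨g, -, rfl⟩
      exact hH g
    · rw [MapOnto.topology_ofFunctions, ← hfT]
      exact functionTopology_anti fun g hg => ⟨H g, ⟨g, hg, rfl⟩, hgH g rfl⟩
    · exact (MapOnto.weight_ofFunctions_le _).trans (max_le (le_max_left _ _) hcard)
  · choose H hH hφH using hφ
    refine ⟨MapOnto.diagonal φ, ⟨⋃₀ range H, hℋ.sUnion_mem _ ?_, ?_⟩, Homeomorph.refl _,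
      fun _ => rfl⟩
    · rintro _ ⟨a, rfl⟩
      exact hH a
    · rw [MapOnto.topology_diagonal, functionTopology_sUnion, iInf_range]
      exact iInf_congr hφH
  · rintro φ ⟨H, hH, hφt⟩ U hU hne
    obtain ⟨V, hV, ⟨x, hx⟩, hVU⟩ := hs H hH U hU hne
    rw [← hφt] at hV
    obtain ⟨O, hO, rfl⟩ := isOpen_induced_iff.1 hV
    refine ⟨φ.toFun x, mem_interior.2 ⟨O, ?_, hO, hx⟩⟩
    intro s hsO
    obtain ⟨y, rfl⟩ := φ.surj s
    obtain ⟨y', hy', hyy'⟩ := hVU hsO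
    exact ⟨y', hy', ((MapOnto.eq_iff_of_topology_eq hφt).2 hyy').symm⟩

end Lattices

/-! ### The inverse system of a chain of sets of functions -/

section EvalSystem

variable {Y : Type u} [TopologicalSpace Y]

/-- The restriction map between the images of the evaluation maps of `H ⊆ K`. -/
def restrictEval {H K : Set C(Y, ℝ)} (h : H ⊆ K) (x : range (evalMap K)) : range (evalMap H) :=
  ⟨fun c => x.1 ⟨c.1, h c.2⟩, by
    obtain ⟨y, hy⟩ := x.2
    exact ⟨y, by rw [← hy]; rfl⟩⟩

theorem continuous_restrictEval {H K : Set C(Y, ℝ)} (h : H ⊆ K) :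
    Continuous (restrictEval h) :=
  (continuous_pi fun c =>
    (continuous_apply (⟨c.1, h c.2⟩ : K)).comp continuous_subtype_val).subtype_mk _

theorem restrictEval_rangeFactorization {H K : Set C(Y, ℝ)} (h : H ⊆ K) (y : Y) :
    restrictEval h (rangeFactorization (evalMap K) y) = rangeFactorization (evalMap H) y :=
  rfl

theorem surjective_restrictEval {H K : Set C(Y, ℝ)} (h : H ⊆ K) :
    Function.Surjective (restrictEval h) := by
  intro x
  obtain ⟨y, rfl⟩ := rangeFactorization_surjective x
  exact ⟨_, restrictEval_rangeFactorization h y⟩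

theorem isSkeletal_restrictEval {H K : Set C(Y, ℝ)} (h : H ⊆ K) (hH : SemiOpenEval H) :
    IsSkeletal (restrictEval h) := by
  intro U hU hne
  have hc : Continuous (rangeFactorization (evalMap K)) := (continuous_evalMap K).subtype_mk _
  obtain ⟨V, hV, ⟨y, hy⟩, hVU⟩ := hH _ (hU.preimage hc)
    (hne.preimage rangeFactorization_surjective)
  obtain ⟨W, hW, rfl⟩ := isOpen_functionTopology_iff.1 hV
  refine ⟨rangeFactorization (evalMap H) y, mem_interior.2
    ⟨Subtype.val ⁻¹' W, ?_, hW.preimage continuous_subtype_val, hy⟩⟩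
  rintro s hs
  obtain ⟨v, rfl⟩ := rangeFactorization_surjective s
  obtain ⟨v', hv', hvv'⟩ := hVU hs
  refine subset_closure ⟨_, hv', ?_⟩
  rw [restrictEval_rangeFactorization]
  exact Subtype.ext (funext fun c => (hvv' c.1 c.2).symm)

theorem hasMetrizableKernel_restrictEval {H K L : Set C(Y, ℝ)} (h : H ⊆ K) (hL : L.Countable)
    (hK : K ⊆ H ∪ L) : HasMetrizableKernel (restrictEval h) := by
  classical
  have : Countable ↥(K ∩ L) := (hL.mono inter_subset_right).to_subtype
  refine ⟨↥(K ∩ L) → ℝ, inferInstance, inferInstance, inferInstance,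
    fun x => (restrictEval h x, fun c => x.1 ⟨c.1, c.2.1⟩), ?_, fun _ => rfl⟩
  refine IsEmbedding.of_comp (g := fun (p : range (evalMap H) × (↥(K ∩ L) → ℝ)) (c : K) =>
    if hc : c.1 ∈ H then p.1.1 ⟨c.1, hc⟩ else
      p.2 ⟨c.1, c.2, (hK c.2).resolve_left hc⟩) ?_ ?_ ?_
  · refine (continuous_restrictEval h).prodMk (continuous_pi fun c => ?_)
    exact (continuous_apply (⟨c.1, c.2.1⟩ : K)).comp continuous_subtype_val
  · refine continuous_pi fun c => ?_
    by_cases hc : c.1 ∈ H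
    · simp only [hc, dite_true]
      exact (continuous_apply (⟨c.1, hc⟩ : H)).comp (continuous_subtype_val.comp continuous_fst)
    · simp only [hc, dite_false]
      exact (continuous_apply _).comp continuous_snd
  · convert! (IsEmbedding.subtypeVal : IsEmbedding (Subtype.val : range (evalMap K) → K → ℝ))
      using 1
    funext x c
    by_cases hc : c.1 ∈ H
    · simp [hc, restrictEval]
    · simp [hc]

variable {I : Type u}

/-- The images of the evaluation maps of an increasing family of sets of functions, with the
restrictions as bonding maps. -/
def evalSystem [Preorder I] (H : I → Set C(Y, ℝ)) (hH : Monotone H) : InvSystem I where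
  space α := range (evalMap (H α))
  bond h := restrictEval (hH h)
  cont h := continuous_restrictEval (hH h)
  bond_self _ _ := rfl
  bond_bond _ _ _ := rfl

/-- The canonical map of `Y` to the limit of `evalSystem`. -/
def toEvalLimit [Preorder I] (H : I → Set C(Y, ℝ)) (hH : Monotone H) (y : Y) :
    (evalSystem H hH).Limit :=
  ⟨fun α => rangeFactorization (evalMap (H α)) y, fun _ _ _ => rfl⟩

theorem isEmbedding_toEvalLimit [T35Space Y] [Preorder I] (H : I → Set C(Y, ℝ)) (hH : Monotone H)
    (hcov : ∀ g, ∃ α, g ∈ H α) : IsEmbedding (toEvalLimit H hH) := by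
  choose r hr using hcov
  refine IsEmbedding.of_comp (g := fun (x : (evalSystem H hH).Limit) (c : (univ : Set C(Y, ℝ))) =>
    (x.1 (r c.1)).1 ⟨c.1, hr c.1⟩) ?_ ?_ ⟨isInducing_evalMap_univ, evalMap_univ_injective⟩
  · exact (continuous_pi fun α => (continuous_evalMap (H α)).subtype_mk _).subtype_mk _
  · refine continuous_pi fun c => ?_
    exact (continuous_apply (⟨c.1, hr c.1⟩ : H (r c.1))).comp
      (continuous_subtype_val.comp ((continuous_apply (r c.1)).comp continuous_subtype_val))

theorem continuous_toLimitBelow [Preorder I] (S : InvSystem I) (γ : I) :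
    Continuous (S.toLimitBelow γ) :=
  (continuous_pi fun α : Iio γ => S.cont (le_of_lt α.2)).subtype_mk _

theorem isEmbedding_toLimitBelow [Preorder I] (H : I → Set C(Y, ℝ)) (hH : Monotone H) {γ : I}
    (hγ : ∀ g ∈ H γ, ∃ α < γ, g ∈ H α) : IsEmbedding ((evalSystem H hH).toLimitBelow γ) := by
  have : Nonempty I := ⟨γ⟩
  choose! r hr hgr using hγ
  refine IsEmbedding.of_comp (g := fun (x : ((evalSystem H hH).below γ).Limit) (c : H γ) =>
    (x.1 ⟨r c.1, hr c.1 c.2⟩).1 ⟨c.1, hgr c.1 c.2⟩) (continuous_toLimitBelow _ γ) ?_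
    IsEmbedding.subtypeVal
  refine continuous_pi fun c => ?_
  exact (continuous_apply (⟨c.1, hgr c.1 c.2⟩ : H (r c.1))).comp
    (continuous_subtype_val.comp ((continuous_apply (⟨r c.1, hr c.1 c.2⟩ : Iio γ)).comp
      continuous_subtype_val))

/-- In a linearly ordered system, the maps to the limit have dense image as soon as the bonding maps
are onto: a basic open set depends on one coordinate. -/
theorem denseRange_toLimitBelow [LinearOrder I] (S : InvSystem I)
    (hS : ∀ α β (h : α < β), Function.Surjective (S.bond h.le)) {γ : I} (hγ : ¬ IsMin γ) :
    DenseRange (S.toLimitBelow γ) := by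
  intro x
  refine mem_closure_iff.2 fun O hO hx => ?_
  obtain ⟨W, hW, rfl⟩ := isOpen_induced_iff.1 hO
  obtain ⟨J, u, hu, hJ⟩ := isOpen_pi_iff.1 hW x.1 hx
  obtain ⟨α₀, hα₀⟩ := not_isMin_iff.1 hγ
  have : Nonempty (Iio γ) := ⟨⟨α₀, hα₀⟩⟩
  obtain ⟨β, hβ⟩ := J.exists_le
  obtain ⟨y, hy⟩ := hS β.1 γ β.2 (x.1 β)
  refine ⟨S.toLimitBelow γ y, hJ fun α hα => ?_, y, rfl⟩
  have h₁ : S.bond (le_of_lt α.2) y = x.1 α := by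
    rw [← S.bond_bond (show α.1 ≤ β.1 from hβ α hα) (le_of_lt β.2) y, hy]
    exact x.2 (hβ α hα)
  change S.bond (le_of_lt α.2) y ∈ u α
  rw [h₁]
  exact (hu α hα).2

/-- Continuous functions on the limit of `evalSystem H` factor through the stage `γ` if `H γ` is
the largest of the sets `H α`. -/
theorem exists_factorization [LinearOrder I] (H : I → Set C(Y, ℝ)) (hH : Monotone H) {γ : I}
    (hγ : ∀ α, H α ⊆ H γ) {f : (evalSystem H hH).Limit → ℝ} (hf : Continuous f) :
    ∃ g : C((evalSystem H hH).space γ, ℝ), ∀ x, f x = g ((evalSystem H hH).proj γ x) := by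
  let s : (evalSystem H hH).space γ → (evalSystem H hH).Limit := fun x =>
    ⟨fun α => restrictEval (hγ α) x, fun _ _ _ => rfl⟩
  have hs : Continuous s :=
    (continuous_pi fun α => continuous_restrictEval (hγ α)).subtype_mk _
  refine ⟨⟨f ∘ s, hf.comp hs⟩, fun x => congrArg f (Subtype.ext (funext fun α => ?_))⟩
  change x.1 α = restrictEval (hγ α) (x.1 γ)
  rcases le_total α γ with h | h
  · exact (x.2 h).symm
  · rw [← x.2 h]
    rfl

end EvalSystem

/-- Every type embeds in a proper initial segment of some infinite initial ordinal, namely that of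
the successor cardinal. -/
theorem exists_injective_bounded (A : Type u) :
    ∃ (τ : Cardinal.{u}) (r : A → τ.ord.ToType) (γ : τ.ord.ToType), ℵ₀ ≤ τ ∧
      Function.Injective r ∧ ∀ a, r a < γ := by
  let κ : Cardinal.{u} := max ℵ₀ #A
  have hlt : κ.ord < (Order.succ κ).ord := Cardinal.ord_lt_ord.2 (Order.lt_succ κ)
  obtain ⟨j⟩ : Nonempty (A ↪ κ.ord.ToType) := by
    rw [← Cardinal.le_def, Cardinal.mk_ord_toType]
    exact le_max_right _ _
  let e := fun o : Iio κ.ord => Ordinal.ToType.mk (⟨o.1, o.2.trans hlt⟩ : Iio (Order.succ κ).ord)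
  refine ⟨Order.succ κ, fun a => e (Ordinal.ToType.mk.symm (j a)), Ordinal.ToType.mk ⟨κ.ord, hlt⟩,
    (le_max_left _ _).trans (Order.le_succ κ), ?_, fun a => ?_⟩
  · intro a b hab
    have h := Ordinal.ToType.mk.injective hab
    have h' : (Ordinal.ToType.mk.symm (j a)).1 = (Ordinal.ToType.mk.symm (j b)).1 :=
      Subtype.mk.inj h
    exact j.injective (Ordinal.ToType.mk.symm.injective (Subtype.ext h'))
  · exact (OrderIso.lt_iff_lt _).2 (Ordinal.ToType.mk.symm (j a)).2

/-- A lattice of semi-open evaluation maps makes the space skeletally Dugundji: well-order the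
continuous functions and adjoin them, each with a countable member of the lattice, one after the
other.  From some stage `γ₀` on the system is constant, because the indices `r g` are bounded, so
that it is factorizing whatever the cofinality of the index set. -/
theorem skeletallyDugundji_of_lattice {Y : Type u} [TopologicalSpace Y] [T35Space Y]
    {ℋ : Set (Set C(Y, ℝ))} (hℋ : IsSetLattice ℋ) (hs : ∀ H ∈ ℋ, SemiOpenEval H) :
    SkeletallyDugundji Y := by
  obtain ⟨τ, r, γ₀, hτ, hr, hγ₀⟩ := exists_injective_bounded C(Y, ℝ)
  choose K hK hKc hgK using fun g : C(Y, ℝ) => hℋ.cofinal {g} (countable_singleton g)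
  let H : τ.ord.ToType → Set C(Y, ℝ) := fun α => ⋃₀ (K '' {g | r g < α})
  have hH : Monotone H := fun α β hαβ =>
    sUnion_subset_sUnion (image_mono fun g (hg : r g < α) => hg.trans_le hαβ)
  have hmem : ∀ α, H α ∈ ℋ := by
    intro α
    refine hℋ.sUnion_mem _ ?_
    rintro _ ⟨g, -, rfl⟩
    exact hK g
  have hgH : ∀ g, g ∈ H γ₀ := fun g => ⟨K g, ⟨g, hγ₀ g, rfl⟩, hgK g rfl⟩
  refine ⟨τ, evalSystem H hH, hτ, fun α β h => ⟨surjective_restrictEval (hH h.le),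
    isSkeletal_restrictEval (hH h.le) (hs _ (hmem α))⟩,
    fun α hα => ?_, fun α β h => ?_, fun γ hγ => ?_,
    ⟨toEvalLimit H hH, isEmbedding_toEvalLimit H hH fun g => ⟨γ₀, hgH g⟩, fun α => ?_⟩,
    fun f => ?_⟩
  · have hempty : H α = ∅ := by
      refine eq_empty_of_forall_notMem ?_
      rintro g ⟨_, ⟨a, ha, rfl⟩, -⟩
      exact hα.not_lt ha
    have : Countable (H α) := by
      rw [hempty]
      infer_instance
    change MetrizableSpace (range (evalMap (H α))) ∧ SeparableSpace (range (evalMap (H α)))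
    exact ⟨inferInstance, inferInstance⟩
  · -- the stage after `α` adjoins the set `K g` for the function `g` of index `α`, if any
    refine hasMetrizableKernel_restrictEval (hH h.le) (L := ⋃ g ∈ {g | r g = α}, K g) ?_ ?_
    · refine Countable.biUnion (Set.Subsingleton.countable ?_) fun g _ => hKc g
      exact fun g (hg : r g = α) g' (hg' : r g' = α) => hr (hg.trans hg'.symm)
    · rintro k ⟨_, ⟨g, hg, rfl⟩, hk⟩
      rcases (h.le_of_lt hg).lt_or_eq with hlt | heq
      · exact Or.inl ⟨K g, ⟨g, hlt, rfl⟩, hk⟩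
      · exact Or.inr (mem_biUnion (show g ∈ {g | r g = α} from heq) hk)
  · refine ⟨isEmbedding_toLimitBelow H hH ?_,
      denseRange_toLimitBelow _ (fun α β h => surjective_restrictEval (hH h.le))
        hγ.not_isMin⟩
    rintro k ⟨_, ⟨g, hg, rfl⟩, hk⟩
    obtain ⟨β, hβ, hβγ⟩ := hγ.isSuccPrelimit.lt_iff_exists_lt.1 hg
    exact ⟨β, hβ, K g, ⟨g, hβγ, rfl⟩, hk⟩
  · refine eq_univ_of_forall fun x => ?_
    obtain ⟨y, hy⟩ := rangeFactorization_surjective x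
    exact ⟨_, ⟨y, rfl⟩, hy⟩
  · obtain ⟨g, hg⟩ := exists_factorization H hH (γ := γ₀) (fun α g _ => hgH g) f.continuous
    exact ⟨γ₀, g, hg⟩

end SkelDug

theorem corollary2p3 {X Y : Type u} [TopologicalSpace X] [T35Space X]
    [TopologicalSpace Y] [T35Space Y] (hXY : SkelDug.CoAbsolute Y X) :
    (SkelDug.HasLatticeOfOpenMaps X → SkelDug.SkeletallyDugundji Y) ∧
    (SkelDug.IsAEZero X →
      SkelDug.HasLatticeOfSemiOpenMaps Y ∧ SkelDug.SkeletallyDugundji Y) := by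
  refine ⟨fun hX => ?_, fun hX => ?_⟩
  · obtain ⟨𝒢, h𝒢, hopen⟩ := hX.exists_open_lattice
    obtain ⟨ℋ, hℋ, hsemi⟩ := SkelDug.exists_semiOpen_lattice hXY h𝒢 hopen
    exact SkelDug.skeletallyDugundji_of_lattice hℋ hsemi
  · obtain ⟨𝒢, h𝒢, hopen⟩ := hX.exists_open_lattice
    obtain ⟨ℋ, hℋ, hsemi⟩ := SkelDug.exists_semiOpen_lattice hXY h𝒢 hopen
    exact ⟨SkelDug.hasLatticeOfSemiOpenMaps_of_lattice hℋ hsemi,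
      SkelDug.skeletallyDugundji_of_lattice hℋ hsemi⟩
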